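/- **Proposition (Graded sliding property).** Let $G$ be an abelian group and $K$ a field of characteristic zero. Let $\mathcal C=\amalg_{\alpha\in G}\mathcal C_\alpha$ be a premodular $G$-category over $K$, that is: $\mathcal C$ is a ribbon category (a monoidal category with left duality $V\mapsto V^*$, a braiding, and a twist compatible with both) whose Hom sets are $K$-modules such that composition and tensor product of morphisms are $K$-bilinear; every object belongs to exactly one of the full subcategories $\mathcal C_\alpha$; $\mathrm{Hom}(V,W)=0$ for $V\in\mathcal C_\alpha$, $W\in\mathcal C_\beta$ with $\alpha\ne\beta$; $V\otimes W\in\mathcal C_{\alpha+\beta}$ and $V^*\in\mathcal C_{-\alpha}$ for $V\in\mathcal C_\alpha$, $W\in\mathcal C_\beta$; and, calling an object $V$ simple if $K\to\mathrm{End}(V)$, $k\mapsto k\,\mathrm{id}_V$, is bijective, the unit object $\mathbb 1$ is simple, the set $I_\alpha$ of isomorphism classes of simple objects of $\mathcal C_\alpha$ is finite for every $\alpha\in G$, and for every $\alpha \in G$ and every $V\in\mathcal C_\alpha$ there are finitely many simple objects $V_r\in\mathcal C_\alpha$ and morphisms $f_r:V_r\to V$, $g_r:V\to V_r$ with $\mathrm{id}_V=\sum_r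 f_rg_r$. For a framed oriented link $L\subset S^3$ with ordered components, denote by $\langle L(X_1,\dots,X_n)\rangle\in\mathrm{End}(\mathbb 1)$ its Reshetikhin–Turaev invariant, extended multilinearly to colors $X_k$ which are formal $K$-linear combinations of objects of $\mathcal C$. Let $\dim(V)\in\mathrm{End}(\mathbb 1)=K$ be the invariant of the $0$-framed unknot colored by $V$, and for $\alpha\in G$ let $$\omega_\alpha=\sum_{i\in I_\alpha}\dim(V_i)\,V_i ,$$ where $V_i$ is a simple object of $\mathcal C_\alpha$ representing $i$. Let $L,L'$ be framed oriented ordered links in $S^3$ with $m+2$ components, $m\ge 0$, such that $L'$ is obtained from $L$ by sliding the second component over the first one: the second component $L_2$ is replaced with its band sum with a parallel copy of the first component $L_1$, pushed off along the framing of $L_1$ and oriented in the same direction as $L_1$, the band being compatible with the orientations, while all the other components (including $L_1$) stay the same. Then for all $\alpha,\beta\in G$, every object $V\in\mathcal C_\beta$ and all $K$-linear combinations $X_1,\dots,X_m$ of objects of $\mathcal C$, $$\langle L(\omega_\alpha,V,X_1,\dots,X_m)\rangle=\langle L'(\omega_{\alpha-\beta},V,X_1,\dots,X_m)\rangle .$$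 -/

import Mathlib

open CategoryTheory MonoidalCategory

namespace GradedSliding

universe v u w

/-! ### Framed oriented tangle diagrams

Tangle diagrams in the plane are drawn upwards and carry the blackboard framing.  Every strand
carries the label of the component it belongs to. -/

/-- A (parenthesised) horizontal row of oriented, labelled points of a diagram. -/
inductive Ob (ι : Type) : Type
  | unit : Ob ι
  | up : ι → Ob ι
  | down : ι → Ob ι
  | tensor : Ob ι → Ob ι → Ob ι

/-- The (finite) type of points of a row. -/
def Ob.Pt {ι : Type} : Ob ι → Type
  | .unit => Empty
  | .up _ => Unit
  | .down _ => Unit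
  | .tensor A B => A.Pt ⊕ B.Pt

/-- The label of a point of a row. -/
def Ob.label {ι : Type} : (A : Ob ι) → A.Pt → ι
  | .unit, p => nomatch p
  | .up i, _ => i
  | .down i, _ => i
  | .tensor A _, .inl p => A.label p
  | .tensor _ B, .inr p => B.label p

/-- Diagrams of framed oriented labelled tangles, read from bottom to top.  `comp f g` puts `g` on
top of `f`, `tensor f g` puts `g` to the right of `f`.  The associators and unitors
are vertical strands (they only change parentheses).  In `cross A B` and `crossInv A B` the
bundle `A` moves from left to right and the bundle `B` from right to left; the two constructors are
the two choices of the bundle which is in front, a crossing of two upward strands in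
`cross` being positive and in `crossInv` negative. -/
inductive Tangle (ι : Type) : Ob ι → Ob ι → Type
  | id (A : Ob ι) : Tangle ι A A
  | comp {A B C : Ob ι} (f : Tangle ι A B) (g : Tangle ι B C) : Tangle ι A C
  | tensor {A B A' B' : Ob ι} (f : Tangle ι A B) (g : Tangle ι A' B') :
      Tangle ι (A.tensor A') (B.tensor B')
  | assoc (A B C : Ob ι) : Tangle ι ((A.tensor B).tensor C) (A.tensor (B.tensor C))
  | assocInv (A B C : Ob ι) : Tangle ι (A.tensor (B.tensor C)) ((A.tensor B).tensor C)
  | lunit (A : Ob ι) : Tangle ι (Ob.unit.tensor A) A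
  | lunitInv (A : Ob ι) : Tangle ι A (Ob.unit.tensor A)
  | runit (A : Ob ι) : Tangle ι (A.tensor Ob.unit) A
  | runitInv (A : Ob ι) : Tangle ι A (A.tensor Ob.unit)
  | cross (A B : Ob ι) : Tangle ι (A.tensor B) (B.tensor A)
  | crossInv (A B : Ob ι) : Tangle ι (A.tensor B) (B.tensor A)
  | cupUD (i : ι) : Tangle ι Ob.unit ((Ob.up i).tensor (Ob.down i))
  | cupDU (i : ι) : Tangle ι Ob.unit ((Ob.down i).tensor (Ob.up i))
  | capDU (i : ι) : Tangle ι ((Ob.down i).tensor (Ob.up i)) Ob.unit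
  | capUD (i : ι) : Tangle ι ((Ob.up i).tensor (Ob.down i)) Ob.unit

namespace Tangle

variable {ι : Type}

/-- The kink on an upward strand which closes up to its right; `x` is its crossing. -/
def kinkRight (i : ι) (x : Tangle ι ((Ob.up i).tensor (Ob.up i)) ((Ob.up i).tensor (Ob.up i))) :
    Tangle ι (Ob.up i) (Ob.up i) :=
  (runitInv _).comp <| ((id _).tensor (cupUD i)).comp <| (assocInv _ _ _).comp <|
    (x.tensor (id _)).comp <| (assoc _ _ _).comp <| ((id _).tensor (capUD i)).comp (runit _)

/-- The kink on an upward strand which closes up to its left; `x` is its crossing. -/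
def kinkLeft (i : ι) (x : Tangle ι ((Ob.up i).tensor (Ob.up i)) ((Ob.up i).tensor (Ob.up i))) :
    Tangle ι (Ob.up i) (Ob.up i) :=
  (lunitInv _).comp <| ((cupDU i).tensor (id _)).comp <| (assoc _ _ _).comp <|
    ((id _).tensor x).comp <| (assocInv _ _ _).comp <| ((capDU i).tensor (id _)).comp (lunit _)

/-- Isotopy of framed oriented tangles, through moves of diagrams: planar isotopy (the axioms of
a monoidal category and the straightening of strands), the second Reidemeister move, moving
any tangle under or over a bundle of strands (which contains the third Reidemeister move), and
the framed form of the first Reidemeister move. -/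
inductive Isotopic : {A B : Ob ι} → Tangle ι A B → Tangle ι A B → Prop
  | refl {A B : Ob ι} (f : Tangle ι A B) : Isotopic f f
  | symm {A B : Ob ι} {f g : Tangle ι A B} : Isotopic f g → Isotopic g f
  | trans {A B : Ob ι} {f g h : Tangle ι A B} : Isotopic f g → Isotopic g h → Isotopic f h
  | comp {A B C : Ob ι} {f f' : Tangle ι A B} {g g' : Tangle ι B C} :
      Isotopic f f' → Isotopic g g' → Isotopic (f.comp g) (f'.comp g')
  | tensor {A B A' B' : Ob ι} {f f' : Tangle ι A B} {g g' : Tangle ι A' B'} :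
      Isotopic f f' → Isotopic g g' → Isotopic (f.tensor g) (f'.tensor g')
  -- monoidal category
  | id_comp {A B : Ob ι} (f : Tangle ι A B) : Isotopic ((id A).comp f) f
  | comp_id {A B : Ob ι} (f : Tangle ι A B) : Isotopic (f.comp (id B)) f
  | comp_assoc {A B C D : Ob ι} (f : Tangle ι A B) (g : Tangle ι B C) (h : Tangle ι C D) :
      Isotopic ((f.comp g).comp h) (f.comp (g.comp h))
  | tensor_id (A B : Ob ι) : Isotopic ((id A).tensor (id B)) (id (A.tensor B))
  | interchange {A B C A' B' C' : Ob ι} (f : Tangle ι A B) (g : Tangle ι B C)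
      (f' : Tangle ι A' B') (g' : Tangle ι B' C') :
      Isotopic ((f.comp g).tensor (f'.comp g')) ((f.tensor f').comp (g.tensor g'))
  | assoc_inv (A B C : Ob ι) : Isotopic ((assoc A B C).comp (assocInv A B C)) (id _)
  | inv_assoc (A B C : Ob ι) : Isotopic ((assocInv A B C).comp (assoc A B C)) (id _)
  | lunit_inv (A : Ob ι) : Isotopic ((lunit A).comp (lunitInv A)) (id _)
  | inv_lunit (A : Ob ι) : Isotopic ((lunitInv A).comp (lunit A)) (id _)
  | runit_inv (A : Ob ι) : Isotopic ((runit A).comp (runitInv A)) (id _)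
  | inv_runit (A : Ob ι) : Isotopic ((runitInv A).comp (runit A)) (id _)
  | assoc_natural {A B C A' B' C' : Ob ι} (f : Tangle ι A A') (g : Tangle ι B B')
      (h : Tangle ι C C') :
      Isotopic (((f.tensor g).tensor h).comp (assoc _ _ _))
        ((assoc _ _ _).comp (f.tensor (g.tensor h)))
  | lunit_natural {A B : Ob ι} (f : Tangle ι A B) :
      Isotopic (((id _).tensor f).comp (lunit B)) ((lunit A).comp f)
  | runit_natural {A B : Ob ι} (f : Tangle ι A B) :
      Isotopic ((f.tensor (id _)).comp (runit B)) ((runit A).comp f)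
  | pentagon (A B C D : Ob ι) :
      Isotopic
        (((assoc A B C).tensor (id D)).comp
          ((assoc A (B.tensor C) D).comp ((id A).tensor (assoc B C D))))
        ((assoc (A.tensor B) C D).comp (assoc A B (C.tensor D)))
  | triangle (A B : Ob ι) :
      Isotopic ((assoc A Ob.unit B).comp ((id A).tensor (lunit B))) ((runit A).tensor (id B))
  -- straightening of strands
  | zigzag_up (i : ι) :
      Isotopic
        ((lunitInv _).comp <| ((cupUD i).tensor (id (Ob.up i))).comp <| (assoc _ _ _).comp <|
          ((id (Ob.up i)).tensor (capDU i)).comp (runit _))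
        (id (Ob.up i))
  | zigzag_down (i : ι) :
      Isotopic
        ((runitInv _).comp <| ((id (Ob.down i)).tensor (cupUD i)).comp <|
          (assocInv _ _ _).comp <| ((capDU i).tensor (id (Ob.down i))).comp (lunit _))
        (id (Ob.down i))
  | zagzig_down (i : ι) :
      Isotopic
        ((lunitInv _).comp <| ((cupDU i).tensor (id (Ob.down i))).comp <| (assoc _ _ _).comp <|
          ((id (Ob.down i)).tensor (capUD i)).comp (runit _))
        (id (Ob.down i))
  | zagzig_up (i : ι) :
      Isotopic
        ((runitInv _).comp <| ((id (Ob.up i)).tensor (cupDU i)).comp <|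
          (assocInv _ _ _).comp <| ((capUD i).tensor (id (Ob.up i))).comp (lunit _))
        (id (Ob.up i))
  -- Reidemeister moves
  | cross_crossInv (A B : Ob ι) : Isotopic ((cross A B).comp (crossInv B A)) (id _)
  | crossInv_cross (A B : Ob ι) : Isotopic ((crossInv A B).comp (cross B A)) (id _)
  | cross_natural {A B A' B' : Ob ι} (f : Tangle ι A A') (g : Tangle ι B B') :
      Isotopic ((f.tensor g).comp (cross A' B')) ((cross A B).comp (g.tensor f))
  | cross_tensor_right (A B C : Ob ι) :
      Isotopic ((assoc A B C).comp ((cross A (B.tensor C)).comp (assoc B C A)))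
        (((cross A B).tensor (id C)).comp ((assoc B A C).comp ((id B).tensor (cross A C))))
  | cross_tensor_left (A B C : Ob ι) :
      Isotopic ((assocInv A B C).comp ((cross (A.tensor B) C).comp (assocInv C A B)))
        (((id A).tensor (cross B C)).comp ((assocInv A C B).comp ((cross A C).tensor (id B))))
  | kink_cross (i : ι) : Isotopic (kinkRight i (cross _ _)) (kinkLeft i (cross _ _))
  | kink_crossInv (i : ι) : Isotopic (kinkRight i (crossInv _ _)) (kinkLeft i (crossInv _ _))

/-! ### Components of a diagram -/

/-- The arcs into which a diagram is cut by the horizontal lines used to build it. -/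
def Arc : {A B : Ob ι} → Tangle ι A B → Type
  | _, _, .id A => A.Pt
  | _, _, .comp f g => f.Arc ⊕ g.Arc
  | _, _, .tensor f g => f.Arc ⊕ g.Arc
  | _, _, .assoc A B C => A.Pt ⊕ (B.Pt ⊕ C.Pt)
  | _, _, .assocInv A B C => A.Pt ⊕ (B.Pt ⊕ C.Pt)
  | _, _, .lunit A => A.Pt
  | _, _, .lunitInv A => A.Pt
  | _, _, .runit A => A.Pt
  | _, _, .runitInv A => A.Pt
  | _, _, .cross A B => A.Pt ⊕ B.Pt
  | _, _, .crossInv A B => A.Pt ⊕ B.Pt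
  | _, _, .cupUD _ => Unit
  | _, _, .cupDU _ => Unit
  | _, _, .capDU _ => Unit
  | _, _, .capUD _ => Unit

/-- The arc which starts at a given bottom point. -/
def bot : {A B : Ob ι} → (f : Tangle ι A B) → A.Pt → f.Arc
  | _, _, .id _, p => p
  | _, _, .comp f _, p => .inl (f.bot p)
  | _, _, .tensor f _, .inl p => .inl (f.bot p)
  | _, _, .tensor _ g, .inr p => .inr (g.bot p)
  | _, _, .assoc _ _ _, p => Equiv.sumAssoc _ _ _ p
  | _, _, .assocInv _ _ _, p => p
  | _, _, .lunit _, .inr p => p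
  | _, _, .lunitInv _, p => p
  | _, _, .runit _, .inl p => p
  | _, _, .runitInv _, p => p
  | _, _, .cross _ _, p => p
  | _, _, .crossInv _ _, p => p
  | _, _, .capDU _, _ => ()
  | _, _, .capUD _, _ => ()

/-- The arc which ends at a given top point. -/
def top : {A B : Ob ι} → (f : Tangle ι A B) → B.Pt → f.Arc
  | _, _, .id _, p => p
  | _, _, .comp _ g, p => .inr (g.top p)
  | _, _, .tensor f _, .inl p => .inl (f.top p)
  | _, _, .tensor _ g, .inr p => .inr (g.top p)
  | _, _, .assoc _ _ _, p => p
  | _, _, .assocInv _ _ _, p => Equiv.sumAssoc _ _ _ p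
  | _, _, .lunit _, p => p
  | _, _, .lunitInv _, .inr p => p
  | _, _, .runit _, p => p
  | _, _, .runitInv _, .inl p => p
  | _, _, .cross _ _, p => Sum.swap p
  | _, _, .crossInv _ _, p => Sum.swap p
  | _, _, .cupUD _, _ => ()
  | _, _, .cupDU _, _ => ()

/-- The label of an arc. -/
def label : {A B : Ob ι} → (f : Tangle ι A B) → f.Arc → ι
  | _, _, .id A, p => A.label p
  | _, _, .comp f g, x => Sum.elim f.label g.label x
  | _, _, .tensor f g, x => Sum.elim f.label g.label x
  | _, _, .assoc A B C, p => (A.tensor (B.tensor C)).label p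
  | _, _, .assocInv A B C, p => (A.tensor (B.tensor C)).label p
  | _, _, .lunit A, p => A.label p
  | _, _, .lunitInv A, p => A.label p
  | _, _, .runit A, p => A.label p
  | _, _, .runitInv A, p => A.label p
  | _, _, .cross A B, p => (A.tensor B).label p
  | _, _, .crossInv A B, p => (A.tensor B).label p
  | _, _, .cupUD i, _ => i
  | _, _, .cupDU i, _ => i
  | _, _, .capDU i, _ => i
  | _, _, .capUD i, _ => i

/-- `f.Glued x y`: the upper end of the arc `x` is a lower end of the arc `y`. -/
def Glued : {A B : Ob ι} → (f : Tangle ι A B) → f.Arc → f.Arc → Prop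
  | _, _, .comp f g, x, y => match x, y with
    | Sum.inl x, Sum.inl y => f.Glued x y
    | Sum.inr x, Sum.inr y => g.Glued x y
    | Sum.inl x, Sum.inr y => ∃ p, x = f.top p ∧ y = g.bot p
    | Sum.inr _, Sum.inl _ => False
  | _, _, .tensor f g, x, y => match x, y with
    | Sum.inl x, Sum.inl y => f.Glued x y
    | Sum.inr x, Sum.inr y => g.Glued x y
    | _, _ => False
  | _, _, _, _, _ => False

/-- For every label, exactly one component of the diagram carries this label. -/
def IsLink (f : Tangle ι Ob.unit Ob.unit) : Prop :=
  ∀ i, (∃ x, f.label x = i) ∧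
    ∀ x y, f.label x = i → f.label y = i → Relation.EqvGen f.Glued x y

end Tangle

/-- A framed oriented link in the three-sphere with components numbered by `Fin n`, given by
a diagram. -/
structure FramedLink (n : ℕ) where
  diagram : Tangle (Fin n) Ob.unit Ob.unit
  isLink : diagram.IsLink

/-! ### Parallels and sliding -/

/-- What a strand is replaced with in a cabling: an upward and a downward bundle of strands, with
the maxima and minima which connect them. -/
structure Strand (κ : Type) where
  up : Ob κ
  down : Ob κ
  cupUD : Tangle κ Ob.unit (up.tensor down)
  cupDU : Tangle κ Ob.unit (down.tensor up)
  capDU : Tangle κ (down.tensor up) Ob.unit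
  capUD : Tangle κ (up.tensor down) Ob.unit

/-- One strand with label `i`. -/
def Strand.single {κ : Type} (i : κ) : Strand κ where
  up := .up i
  down := .down i
  cupUD := .cupUD i
  cupDU := .cupDU i
  capDU := .capDU i
  capUD := .capUD i

/-- A minimum `g` nested inside of a minimum `f`. -/
def nestCup {κ : Type} {A A' B B' : Ob κ} (f : Tangle κ Ob.unit (A.tensor A'))
    (g : Tangle κ Ob.unit (B.tensor B')) :
    Tangle κ Ob.unit ((A.tensor B).tensor (B'.tensor A')) :=
  f.comp <| (Tangle.tensor (.id A) ((Tangle.lunitInv A').comp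
    ((g.tensor (.id A')).comp (.assoc B B' A')))).comp (.assocInv A B (B'.tensor A'))

/-- A maximum `g` nested inside of a maximum `f`. -/
def nestCap {κ : Type} {A A' B B' : Ob κ} (f : Tangle κ (A.tensor A') Ob.unit)
    (g : Tangle κ (B.tensor B') Ob.unit) :
    Tangle κ ((A.tensor B).tensor (B'.tensor A')) Ob.unit :=
  (Tangle.assoc A B (B'.tensor A')).comp <| (Tangle.tensor (.id A)
    ((Tangle.assocInv B B' A').comp ((g.tensor (.id A')).comp (.lunit A')))).comp f

/-- Two parallel strands with the same direction, `T` being on the right hand side of `S`. -/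
def Strand.parallel {κ : Type} (S T : Strand κ) : Strand κ where
  up := S.up.tensor T.up
  down := T.down.tensor S.down
  cupUD := nestCup S.cupUD T.cupUD
  cupDU := nestCup T.cupDU S.cupDU
  capDU := nestCap T.capDU S.capDU
  capUD := nestCap S.capUD T.capUD

/-- Replace each point with label `i` by the bundle `S i`. -/
def Ob.cable {ι κ : Type} (S : ι → Strand κ) : Ob ι → Ob κ
  | .unit => .unit
  | .up i => (S i).up
  | .down i => (S i).down
  | .tensor A B => .tensor (A.cable S) (B.cable S)

/-- Replace each strand with label `i` by the bundle `S i`, along the blackboard framing. -/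
def Tangle.cable {ι κ : Type} (S : ι → Strand κ) :
    {A B : Ob ι} → Tangle ι A B → Tangle κ (A.cable S) (B.cable S)
  | _, _, .id _ => .id _
  | _, _, .comp f g => .comp (f.cable S) (g.cable S)
  | _, _, .tensor f g => .tensor (f.cable S) (g.cable S)
  | _, _, .assoc _ _ _ => .assoc _ _ _
  | _, _, .assocInv _ _ _ => .assocInv _ _ _
  | _, _, .lunit _ => .lunit _
  | _, _, .lunitInv _ => .lunitInv _
  | _, _, .runit _ => .runit _
  | _, _, .runitInv _ => .runitInv _
  | _, _, .cross _ _ => .cross _ _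
  | _, _, .crossInv _ _ => .crossInv _ _
  | _, _, .cupUD i => (S i).cupUD
  | _, _, .cupDU i => (S i).cupDU
  | _, _, .capDU i => (S i).capDU
  | _, _, .capUD i => (S i).capUD

section Slide

variable {m : ℕ}

/-- The label of the first component. -/
abbrev fst : Fin (m + 2) := 0

/-- The label of the second component. -/
abbrev snd : Fin (m + 2) := Fin.succ 0

/-- Double the first component; the parallel copy gets the label of the second component. -/
def doubleFst : Fin (m + 2) → Strand (Fin (m + 2)) :=
  Fin.cons (Strand.parallel (.single fst) (.single snd)) fun j => .single j.succ

/-- A row in which an upward strand of the first component is directly to the left of a downward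
strand of the second component. -/
abbrev spot (A B : Ob (Fin (m + 2))) : Ob (Fin (m + 2)) :=
  A.tensor (((Ob.up fst).tensor (Ob.down snd)).tensor B)

/-- The band sum of the upward parallel copy of the first component with the downward strand
of the second component next to it. -/
def band : Tangle (Fin (m + 2)) (((Ob.up fst).tensor (Ob.up snd)).tensor (Ob.down snd))
    (((Ob.up fst).tensor (Ob.up snd)).tensor (Ob.down snd)) :=
  (Tangle.assoc _ _ _).comp <|
    (Tangle.tensor (.id _) ((Tangle.capUD snd).comp (.cupUD snd))).comp (.assocInv _ _ _)

/-- The result of sliding the second component over the first one in the diagram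
`P.comp Q`, at the place between `P` and `Q` where the two components run side by side: the first
component is doubled along its framing, and the second component is joined by a band to
the parallel copy. -/
def slide {A B : Ob (Fin (m + 2))} (P : Tangle (Fin (m + 2)) Ob.unit (spot A B))
    (Q : Tangle (Fin (m + 2)) (spot A B) Ob.unit) : Tangle (Fin (m + 2)) Ob.unit Ob.unit :=
  (P.cable doubleFst).comp <|
    (Tangle.tensor (.id (A.cable doubleFst))
      (Tangle.tensor band (.id (B.cable doubleFst)))).comp (Q.cable doubleFst)

/-- `L'` is obtained from `L`, up to isotopy, by sliding the second component over the first
one, the orientations of the second component and of the parallel copy of the first one being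
compatible with the band. -/
def FramedLink.IsSlide (L L' : FramedLink (m + 2)) : Prop :=
  ∃ (A B : Ob (Fin (m + 2))) (P : Tangle (Fin (m + 2)) Ob.unit (spot A B))
    (Q : Tangle (Fin (m + 2)) (spot A B) Ob.unit),
    (P.comp Q).IsLink ∧ L.diagram.Isotopic (P.comp Q) ∧ L'.diagram.Isotopic (slide P Q)

end Slide

/-! ### Ribbon categories and invariants of links

`RightRigidCategory` provides the objects `Vᘁ` with morphisms `𝟙_ C ⟶ V ⊗ Vᘁ` and
`Vᘁ ⊗ V ⟶ 𝟙_ C`. -/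

/-- A twist compatible with the braiding and with the duality. -/
class RibbonCategory (C : Type u) [Category.{v} C] [MonoidalCategory C] [BraidedCategory C]
    [RightRigidCategory C] where
  twist (V : C) : V ≅ V
  twist_natural {V W : C} (f : V ⟶ W) : f ≫ (twist W).hom = (twist V).hom ≫ f
  twist_tensor (V W : C) : (twist (V ⊗ W)).hom =
    ((twist V).hom ⊗ₘ (twist W).hom) ≫ (β_ V W).hom ≫ (β_ W V).hom
  twist_dual (V : C) :
    η_ V Vᘁ ≫ ((twist V).hom ▷ Vᘁ) = η_ V Vᘁ ≫ (V ◁ (twist Vᘁ).hom)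

section Invariant

variable {C : Type u} [Category.{v} C] [MonoidalCategory C] [BraidedCategory C]
  [RightRigidCategory C]

/-- The object of a row whose points are coloured by `X`. -/
def Ob.eval {ι : Type} (X : ι → C) : Ob ι → C
  | .unit => 𝟙_ C
  | .up i => X i
  | .down i => (X i)ᘁ
  | .tensor A B => A.eval X ⊗ B.eval X

variable [RibbonCategory C]

/-- The operator invariant of a tangle whose components are coloured by `X`. -/
def Tangle.eval {ι : Type} (X : ι → C) :
    {A B : Ob ι} → Tangle ι A B → (A.eval X ⟶ B.eval X)
  | _, _, .id _ => 𝟙 _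
  | _, _, .comp f g => f.eval X ≫ g.eval X
  | _, _, .tensor f g => f.eval X ⊗ₘ g.eval X
  | _, _, .assoc _ _ _ => (α_ _ _ _).hom
  | _, _, .assocInv _ _ _ => (α_ _ _ _).inv
  | _, _, .lunit _ => (λ_ _).hom
  | _, _, .lunitInv _ => (λ_ _).inv
  | _, _, .runit _ => (ρ_ _).hom
  | _, _, .runitInv _ => (ρ_ _).inv
  | _, _, .cross A B => (β_ (A.eval X) (B.eval X)).hom
  | _, _, .crossInv A B => (β_ (B.eval X) (A.eval X)).inv
  | _, _, .cupUD i => η_ (X i) (X i)ᘁ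
  | _, _, .cupDU i => η_ (X i) (X i)ᘁ ≫ (β_ (X i) (X i)ᘁ).hom ≫
      ((X i)ᘁ ◁ (RibbonCategory.twist (X i)).hom)
  | _, _, .capDU i => ε_ (X i) (X i)ᘁ
  | _, _, .capUD i => ((RibbonCategory.twist (X i)).hom ▷ (X i)ᘁ) ≫
      (β_ (X i) (X i)ᘁ).hom ≫ ε_ (X i) (X i)ᘁ

/-- The invariant of a framed link whose components are coloured by `K`-linear combinations
of objects, by multilinear extension. -/
def FramedLink.bracket {K : Type w} [Field K] [Preadditive C] [Linear K C] {n : ℕ}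
    (L : FramedLink n) (X : Fin n → (C →₀ K)) : 𝟙_ C ⟶ 𝟙_ C :=
  ∑ c ∈ Fintype.piFinset fun i => (X i).support, (∏ i, X i (c i)) • L.diagram.eval c

/-- The unknot with framing zero. -/
def unknot : FramedLink 1 where
  diagram := (Tangle.cupUD 0).comp (.capUD 0)
  isLink i := by
    refine ⟨⟨.inl (), Subsingleton.elim _ _⟩, ?_⟩
    have h : ((Tangle.cupUD (0 : Fin 1)).comp (.capUD 0)).Glued (.inl ()) (.inr ()) :=
      ⟨.inl (), rfl, rfl⟩
    rintro (⟨⟩ | ⟨⟩) (⟨⟩ | ⟨⟩) _ _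
    · exact .refl _
    · exact .rel _ _ h
    · exact .symm _ _ (.rel _ _ h)
    · exact .refl _

/-- The dimension of an object, in `End (𝟙_ C)`. -/
def qdim (V : C) : 𝟙_ C ⟶ 𝟙_ C := unknot.diagram.eval fun _ => V

end Invariant

/-! ### Premodular `G`-categories -/

/-- A splitting of a `K`-additive monoidal category with duality into full subcategories
`C_α`, `α ∈ G`; `C_α` consists of the objects `V` with `deg V = α`. -/
class GGrading (G : Type*) [AddCommGroup G] (C : Type u) [Category.{v} C] [MonoidalCategory C]
    [Preadditive C] [RightRigidCategory C] where
  deg : C → G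
  hom_eq_zero {V W : C} (h : deg V ≠ deg W) (f : V ⟶ W) : f = 0
  deg_tensor (V W : C) : deg (V ⊗ W) = deg V + deg W
  deg_dual (V : C) : deg (Vᘁ) = - deg V

/-- `End V = K · id_V`. -/
def IsSimpleObj (K : Type w) [Field K] {C : Type u} [Category.{v} C] [Preadditive C] [Linear K C]
    (V : C) : Prop :=
  Function.Bijective fun k : K => k • 𝟙 V

section Premodular

variable (K : Type w) [Field K] (G : Type*) [AddCommGroup G]
  (C : Type u) [Category.{v} C] [MonoidalCategory C] [Preadditive C] [Linear K C]
  [RightRigidCategory C] [GGrading G C]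

/-- The simple objects of `C_α`. -/
def SimpleObj (α : G) : Type u := {V : C // IsSimpleObj K V ∧ GGrading.deg V = α}

/-- The relation of being isomorphic in `C`. -/
def simpleSetoid (α : G) : Setoid (SimpleObj K G C α) :=
  (isIsomorphicSetoid C).comap Subtype.val

/-- The set `I_α` of isomorphism classes of simple objects of `C_α`. -/
def SimpleClass (α : G) : Type u := Quotient (simpleSetoid K G C α)

/-- The axioms which make a ribbon `G`-category premodular. -/
class Premodular : Prop where
  unit_simple : IsSimpleObj K (𝟙_ C)
  finite_simple (α : G) : Finite (SimpleClass K G C α)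
  dominated (V : C) : ∃ (n : ℕ) (S : Fin n → SimpleObj K G C (GGrading.deg V))
    (f : ∀ r, (S r).1 ⟶ V) (g : ∀ r, V ⟶ (S r).1), 𝟙 V = ∑ r, g r ≫ f r

variable [Premodular K G C] [BraidedCategory C] [RibbonCategory C]

variable {C} in
/-- The dimension of an object, as an element of `K = End (𝟙_ C)`. -/
noncomputable def dimScalar (V : C) : K :=
  (Equiv.ofBijective _ (Premodular.unit_simple (K := K) (G := G) (C := C))).symm (qdim V)

/-- A choice of a representative of each isomorphism class of simple objects. -/
structure Representatives where
  obj (α : G) : SimpleClass K G C α → SimpleObj K G C α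
  mk_obj (α : G) (i : SimpleClass K G C α) : Quotient.mk (simpleSetoid K G C α) (obj α i) = i

variable {K G C}

/-- The formal linear combination `ω_α = ∑ dim (V_i) V_i` over `i ∈ I_α`. -/
noncomputable def omega (R : Representatives K G C) (α : G) : C →₀ K :=
  haveI := Premodular.finite_simple (K := K) (C := C) α
  letI := Fintype.ofFinite (SimpleClass K G C α)
  ∑ i, Finsupp.single (R.obj α i).1 (dimScalar K G (R.obj α i).1)

end Premodular

end GradedSliding

open GradedSliding

/-! Write T for the simple objects of degree α, W for those of degree α - β, and V for the colour of
the second component. In the slid diagram the first component and its parallel copy, coloured W and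
V, act as one component coloured W ⊗ V, and the band becomes a coupon which factors through W
(`eval_slide`, `bandHom_eq`). Since W ⊗ V has degree α, its identity is a sum of morphisms through
objects T, and carrying one factor of each summand once around the component recolours that
component by T (`spotEval_cyclic`). In the original diagram coloured T, the identity of T ⊗ Vᘁ,
which has degree α - β, is decomposed through objects W. Both sides are now double sums over pairs
(T, W) of closed diagrams whose first component has colour T, and they are compared pair by pair
(`dimScalar_smul_sum_spotEval`).

For one pair, duality identifies Hom(T ⊗ Vᘁ, W) with Hom(T, W ⊗ V). Given x : T ⟶ W ⊗ V and p : W ⊗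
V ⟶ T, the composite x ≫ p is a scalar b on T and the partial trace of p ≫ x is a scalar a on W.
Cyclicity of the trace gives dim T · b = dim W · a (`dimScalar_mul_eq`), which is what the weights
in ω are made for. No dual bases and no invertible dimensions are needed.

Two points need care. Simplicity only means End = K, so a morphism ρ between non-isomorphic simple
objects is not known to vanish; but all composites ρ ≫ κ back to its source do
(`IsSimpleObj.comp_eq_zero`), and a closed diagram containing ρ is the trace of such a composite
(`exists_whisker_eq_tr_comp`), so ρ does not contribute. Secondly, carrying a morphism around a
component has to be derived from the diagram: for a retraction the idempotent is spread over all
arcs of the component, where it amounts to a change of colour (`spotEval_of_retract`), and linearity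
gives the case of a simple target.

All this rests on the isotopy invariance `Tangle.Isotopic.eval_eq` and on the cabling formula
`Tangle.eval_cable`. -/

namespace GradedSliding

universe v u w

/-! ### Duality and twist in a ribbon category -/

section Ribbon

variable {C : Type u} [Category.{v} C] [MonoidalCategory C]

/-- Two exact pairings with the same coevaluation have the same evaluation. -/
theorem evaluation_eq_of_coevaluation_eq {X Y : C} (p q : ExactPairing X Y)
    (h : @ExactPairing.coevaluation _ _ _ X Y p = @ExactPairing.coevaluation _ _ _ X Y q) :
    @ExactPairing.evaluation _ _ _ X Y p = @ExactPairing.evaluation _ _ _ X Y q := by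
  have hp := @ExactPairing.evaluation_coevaluation _ _ _ X Y p
  have hq := @ExactPairing.coevaluation_evaluation _ _ _ X Y q
  rw [h] at hp
  generalize @ExactPairing.evaluation _ _ _ X Y p = e at *
  generalize @ExactPairing.evaluation _ _ _ X Y q = e' at *
  generalize @ExactPairing.coevaluation _ _ _ X Y q = c at *
  calc e = 𝟙 _ ⊗≫ (Y ◁ c ≫ (α_ _ _ _).inv ≫ e' ▷ Y) ▷ X ⊗≫ e := by rw [hq]; monoidal
    _ = 𝟙 _ ⊗≫ Y ◁ c ▷ X ⊗≫ (e' ▷ (Y ⊗ X) ≫ 𝟙_ C ◁ e) ⊗≫ 𝟙 _ := by monoidal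
    _ = 𝟙 _ ⊗≫ Y ◁ (c ▷ X ≫ (α_ _ _ _).hom ≫ X ◁ e) ⊗≫ e' ⊗≫ 𝟙 _ := by
      rw [← whisker_exchange]; monoidal
    _ = e' := by rw [hp]; monoidal

/-- A zigzag inserted below `g` moves it onto a minimum, where `h` replaces it by `f` on the other
leg; straightening then leaves `f` at the maximum. -/
theorem whiskerLeft_comp_evaluation {X X' : C} [ExactPairing X X'] {f : X ⟶ X} {g : X' ⟶ X'}
    (h : η_ X X' ≫ f ▷ X' = η_ X X' ≫ X ◁ g) :
    X' ◁ f ≫ ε_ X X' = g ▷ X ≫ ε_ X X' := by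
  symm
  calc g ▷ X ≫ ε_ X X'
      = 𝟙 _ ⊗≫ (X' ◁ η_ X X' ≫ (α_ _ _ _).inv ≫ ε_ X X' ▷ X') ▷ X ⊗≫ g ▷ X ≫ ε_ X X' := by
        rw [ExactPairing.coevaluation_evaluation]; monoidal
    _ = 𝟙 _ ⊗≫ X' ◁ η_ X X' ▷ X ⊗≫ (ε_ X X' ▷ X' ≫ 𝟙_ C ◁ g) ▷ X ⊗≫ ε_ X X' := by monoidal
    _ = 𝟙 _ ⊗≫ X' ◁ (η_ X X' ≫ X ◁ g) ▷ X ⊗≫ ε_ X X' ▷ X' ▷ X ⊗≫ ε_ X X' := by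
        rw [← whisker_exchange]; monoidal
    _ = 𝟙 _ ⊗≫ X' ◁ (η_ X X' ≫ f ▷ X') ▷ X ⊗≫ (ε_ X X' ▷ (X' ⊗ X) ≫ 𝟙_ C ◁ ε_ X X') ⊗≫ 𝟙 _ := by
        rw [h]; monoidal
    _ = 𝟙 _ ⊗≫ X' ◁ η_ X X' ▷ X ⊗≫ X' ◁ (f ▷ (X' ⊗ X) ≫ X ◁ ε_ X X') ⊗≫ ε_ X X' ⊗≫ 𝟙 _ := by
        rw [← whisker_exchange]; monoidal
    _ = 𝟙 _ ⊗≫ X' ◁ (η_ X X' ▷ X ≫ (α_ _ _ _).hom ≫ X ◁ ε_ X X') ⊗≫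
          (X' ◁ f ≫ ε_ X X') ⊗≫ 𝟙 _ := by
        rw [← whisker_exchange]; monoidal
    _ = _ := by rw [ExactPairing.evaluation_coevaluation]; monoidal

/-- The comparison of two duals is the mate of `𝟙 X`, so this is an instance of the mate relation.
-/
theorem coevaluation_comp_rightDualIso {X Y₁ Y₂ : C} (p₁ : ExactPairing X Y₁)
    (p₂ : ExactPairing X Y₂) :
    η_ X Y₁ ≫ X ◁ (rightDualIso p₁ p₂).hom = η_ X Y₂ := by
  have := @coevaluation_comp_rightAdjointMate _ _ _ X X ⟨Y₂⟩ ⟨Y₁⟩ (𝟙 X)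
  rw [id_whiskerRight, Category.comp_id] at this
  exact this

theorem rightDualIso_comp_evaluation {X Y₁ Y₂ : C} (p₁ : ExactPairing X Y₁)
    (p₂ : ExactPairing X Y₂) :
    (rightDualIso p₁ p₂).hom ▷ X ≫ ε_ X Y₂ = ε_ X Y₁ := by
  have := @rightAdjointMate_comp_evaluation _ _ _ X X ⟨Y₂⟩ ⟨Y₁⟩ (𝟙 X)
  rw [whiskerLeft_id, Category.id_comp] at this
  exact this

/-- The change of objects in `hq` is the identity on `U` and `V`, so it slides past the coupon and
is absorbed by `hp`. -/
theorem comp_conj_whisker {A A' B B' U V : C} {X Y : C} (iA : A' ⟶ A) (iB : B' ⟶ B)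
    {p' : X ⟶ A' ⊗ ((U ⊗ V) ⊗ B')} {p : X ⟶ A ⊗ ((U ⊗ V) ⊗ B)}
    {q' : A' ⊗ ((U ⊗ V) ⊗ B') ⟶ Y} {q : A ⊗ ((U ⊗ V) ⊗ B) ⟶ Y}
    (hp : p' ≫ (iA ⊗ₘ ((𝟙 U ⊗ₘ 𝟙 V) ⊗ₘ iB)) = p)
    (hq : q' = (iA ⊗ₘ ((𝟙 U ⊗ₘ 𝟙 V) ⊗ₘ iB)) ≫ q) {b b' : U ⊗ V ⟶ U ⊗ V} (hb : b' = b) :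
    p' ≫ (𝟙 A' ⊗ₘ (b' ⊗ₘ 𝟙 B')) ≫ q' = p ≫ (A ◁ (b ▷ B)) ≫ q := by
  subst hb
  rw [← hp, hq, ← id_tensorHom A, ← tensorHom_id _ B]
  simp only [Category.assoc]
  rw [tensorHom_comp_tensorHom_assoc, tensorHom_comp_tensorHom_assoc, tensorHom_comp_tensorHom,
    tensorHom_comp_tensorHom]
  simp

variable [BraidedCategory C]

/-- A strand sliding over a minimum. -/
theorem whiskerLeft_comp_braiding {X Y Z : C} (c : 𝟙_ C ⟶ Y ⊗ Z) :
    (ρ_ X).inv ≫ X ◁ c ≫ (β_ X (Y ⊗ Z)).hom = (λ_ X).inv ≫ c ▷ X := by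
  rw [BraidedCategory.braiding_naturality_right]; simp

variable [RightRigidCategory C] [RibbonCategory C]

open RibbonCategory

/-- Naturality along `λ_ (𝟙_ C)` and `twist_tensor` make the twist of the unit idempotent, and it is
invertible. -/
theorem twist_unit : (twist (𝟙_ C)).hom = 𝟙 _ := by
  have h2 := twist_natural (λ_ (𝟙_ C)).hom
  rw [twist_tensor, tensorHom_def'] at h2
  simp only [Category.assoc, braiding_tensorUnit_left, unitors_equal, Iso.hom_inv_id,
    Category.comp_id] at h2
  rw [rightUnitor_naturality, ← unitors_equal, leftUnitor_naturality_assoc,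
    Iso.cancel_iso_hom_left] at h2
  exact (Iso.cancel_iso_hom_left (twist (𝟙_ C)) _ _).1 (by simpa using h2.symm)

/-- The axiom `twist_dual` concerns the chosen dual; naturality of the twist transports it along
`rightDualIso`. Arbitrary duals are needed because Y' ⊗ X' serves as a dual of X ⊗ Y. -/
theorem coev_twist (X X' : C) [p : ExactPairing X X'] :
    η_ X X' ≫ (twist X).hom ▷ X' = η_ X X' ≫ X ◁ (twist X').hom := by
  rw [← coevaluation_comp_rightDualIso (Y₁ := Xᘁ) inferInstance p]
  simp only [Category.assoc]
  rw [whisker_exchange, ← Category.assoc, twist_dual, Category.assoc,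
    ← whiskerLeft_comp, ← whiskerLeft_comp, twist_natural]

theorem ev_twist (X X' : C) [ExactPairing X X'] :
    X' ◁ (twist X).hom ≫ ε_ X X' = (twist X').hom ▷ X ≫ ε_ X X' :=
  whiskerLeft_comp_evaluation (coev_twist X X')

/-- The coevaluation of the pairing of a dual with the object, in a ribbon category. -/
def coevL (X X' : C) [ExactPairing X X'] : 𝟙_ C ⟶ X' ⊗ X :=
  η_ X X' ≫ (β_ X X').hom ≫ X' ◁ (twist X).hom

/-- The evaluation of the pairing of a dual with the object, in a ribbon category. -/
def evL (X X' : C) [ExactPairing X X'] : X ⊗ X' ⟶ 𝟙_ C :=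
  (twist X).hom ▷ X' ≫ (β_ X X').hom ≫ ε_ X X'

/-- The twist of X ⊗ X' acts trivially on the coevaluation, by naturality and `twist_unit`.
Expanding it by `twist_tensor` and moving the twist of X' to X shows that the double braiding
cancels two twists of X. -/
theorem coevL_eq (X X' : C) [ExactPairing X X'] :
    coevL X X' = η_ X X' ≫ (β_ X' X).inv ≫ X' ◁ (twist X).inv := by
  have h := twist_natural (η_ X X')
  rw [twist_unit, Category.id_comp, twist_tensor, tensorHom_def', Category.assoc,
    ← Category.assoc (η_ X X'), ← coev_twist, Category.assoc] at h
  rw [coevL, ← BraidedCategory.braiding_naturality_left]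
  rw [← cancel_mono (X' ◁ (twist X).hom), ← cancel_mono (β_ X' X).hom]
  simp only [Category.assoc, ← whiskerLeft_comp, Iso.inv_hom_id, whiskerLeft_id,
    Category.comp_id]
  rw [← BraidedCategory.braiding_naturality_left_assoc, h]

theorem evL_eq (X X' : C) [ExactPairing X X'] :
    evL X X' = (twist X).inv ▷ X' ≫ (β_ X' X).inv ≫ ε_ X X' := by
  have h := twist_natural (ε_ X X')
  rw [twist_unit, Category.comp_id, twist_tensor] at h
  have h' : ε_ X X' = X' ◁ ((twist X).hom ≫ (twist X).hom) ≫ (β_ X' X).hom ≫ (β_ X X').hom ≫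
      ε_ X X' := by
    conv_lhs => rw [h]
    rw [MonoidalCategory.tensorHom_def]
    simp only [Category.assoc, whiskerLeft_comp]
    simp only [BraidedCategory.braiding_naturality_right_assoc,
      BraidedCategory.braiding_naturality_left_assoc]
    rw [← whisker_exchange_assoc, ← ev_twist]
  rw [evL, ← cancel_epi ((twist X).hom ▷ X'), hom_inv_whiskerRight_assoc,
    ← cancel_epi (β_ X' X).hom, Iso.hom_inv_id_assoc]
  conv_rhs => rw [h']
  simp

/-- In a ribbon category, a dual of an object is also a dual on the other side. -/
abbrev ribbonPairing (X X' : C) [ExactPairing X X'] : ExactPairing X' X where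
  coevaluation' := coevL X X'
  evaluation' := evL X X'
  coevaluation_evaluation' := by
    -- The braiding alone gives a pairing whose coevaluation uses the inverse braiding. In the form
    -- `coevL_eq` the inverse twist of `coevL` cancels the twist of `evL`, which reduces the zigzag
    -- to that pairing.
    have h := (BraidedCategory.exactPairing_swap X X').coevaluation_evaluation'
    change X ◁ (η_ X X' ≫ (β_ X' X).inv) ≫ (α_ X X' X).inv ≫ ((β_ X X').hom ≫ ε_ X X') ▷ X =
      (ρ_ X).hom ≫ (λ_ X).inv at h
    rw [coevL_eq, evL]
    calc _ = 𝟙 _ ⊗≫ X ◁ (η_ X X' ≫ (β_ X' X).inv) ⊗≫ X ◁ (X' ◁ (twist X).inv) ⊗≫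
              (twist X).hom ▷ (X' ⊗ X) ⊗≫ ((β_ X X').hom ≫ ε_ X X') ▷ X := by monoidal
      _ = 𝟙 _ ⊗≫ X ◁ (η_ X X' ≫ (β_ X' X).inv) ⊗≫ ((twist X).hom ▷ (X' ⊗ X) ≫
              X ◁ (X' ◁ (twist X).inv)) ⊗≫ ((β_ X X').hom ≫ ε_ X X') ▷ X := by
            rw [← whisker_exchange]; monoidal
      _ = (X ◁ (η_ X X' ≫ (β_ X' X).inv) ≫ (twist X).hom ▷ _) ⊗≫ (((X ⊗ X') ◁ (twist X).inv) ≫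
              ((β_ X X').hom ≫ ε_ X X') ▷ X) := by monoidal
      _ = ((twist X).hom ▷ _ ≫ X ◁ (η_ X X' ≫ (β_ X' X).inv)) ⊗≫ (((X ⊗ X') ◁ (twist X).inv) ≫
              ((β_ X X').hom ≫ ε_ X X') ▷ X) := by
            rw [whisker_exchange (twist X).hom]
      _ = (twist X).hom ▷ _ ≫ (X ◁ (η_ X X' ≫ (β_ X' X).inv) ≫ (α_ X X' X).inv ≫
              ((β_ X X').hom ≫ ε_ X X') ▷ X) ≫ _ ◁ (twist X).inv := by
            rw [whisker_exchange]; monoidal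
      _ = _ := by rw [h]; simp
  evaluation_coevaluation' := by
    have h := (BraidedCategory.exactPairing_swap X X').evaluation_coevaluation'
    change (η_ X X' ≫ (β_ X' X).inv) ▷ X' ≫ (α_ X' X X').hom ≫ X' ◁ ((β_ X X').hom ≫ ε_ X X') =
      (λ_ X').hom ≫ (ρ_ X').inv at h
    rw [coevL_eq, evL]
    calc _ = (η_ X X' ≫ (β_ X' X).inv) ▷ X' ⊗≫ X' ◁ ((twist X).inv ≫ (twist X).hom) ▷ X' ⊗≫
            X' ◁ ((β_ X X').hom ≫ ε_ X X') := by monoidal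
      _ = (η_ X X' ≫ (β_ X' X).inv) ▷ X' ≫ (α_ X' X X').hom ≫ X' ◁ ((β_ X X').hom ≫ ε_ X X') := by
            rw [Iso.inv_hom_id]; monoidal
      _ = _ := h

theorem coevL_evL_comp (X X' : C) [ExactPairing X X'] {Z : C} (h : 𝟙_ C ⊗ X ⟶ Z) :
    X ◁ coevL X X' ≫ (α_ X X' X).inv ≫ evL X X' ▷ X ≫ h = (ρ_ X).hom ≫ (λ_ X).inv ≫ h := by
  have := (ribbonPairing X X').coevaluation_evaluation' =≫ h
  simp only [Category.assoc] at this
  exact this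

theorem evL_coevL_comp (X X' : C) [ExactPairing X X'] {Z : C} (h : X' ⊗ 𝟙_ C ⟶ Z) :
    coevL X X' ▷ X' ≫ (α_ X' X X').hom ≫ X' ◁ evL X X' ≫ h = (λ_ X').hom ≫ (ρ_ X').inv ≫ h := by
  have := (ribbonPairing X X').evaluation_coevaluation' =≫ h
  simp only [Category.assoc] at this
  exact this

end Ribbon

/-! ### Isotopy invariance of the operator invariant -/

section Invariance

variable {C : Type u} [Category.{v} C] [MonoidalCategory C] [BraidedCategory C]
  [RightRigidCategory C] [RibbonCategory C]

open RibbonCategory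

/-- The twist contained in `evL` moves down through the crossing to the bottom, and what remains is
a strand sliding over a minimum. A kink thus gives the twist or its inverse according to its
crossing alone, whichever side it closes on; this is the framed first Reidemeister move. -/
theorem kink_right_braiding (X X' : C) [ExactPairing X X'] :
    (ρ_ X).inv ≫ X ◁ η_ X X' ≫ (α_ X X X').inv ≫ (β_ X X).hom ▷ X' ≫ (α_ X X X').hom ≫
      X ◁ evL X X' ≫ (ρ_ X).hom = (twist X).hom := by
  calc _ = (ρ_ X).inv ≫ X ◁ η_ X X' ≫ (α_ X X X').inv ≫ ((β_ X X).hom ≫ X ◁ (twist X).hom) ▷ X' ≫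
        (α_ X X X').hom ≫ X ◁ ((β_ X X').hom ≫ ε_ X X') ≫ (ρ_ X).hom := by
        rw [evL]; monoidal
    _ = (ρ_ X).inv ≫ (X ◁ η_ X X' ≫ (twist X).hom ▷ _) ≫ (α_ X X X').inv ≫ ((β_ X X).hom) ▷ X' ≫
        (α_ X X X').hom ≫ X ◁ ((β_ X X').hom ≫ ε_ X X') ≫ (ρ_ X).hom := by
        rw [← BraidedCategory.braiding_naturality_left]; monoidal
    _ = (twist X).hom ≫ ((ρ_ X).inv ≫ X ◁ η_ X X' ≫ (β_ X (X ⊗ X')).hom) ≫ (α_ _ _ _).hom ≫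
        X ◁ ε_ X X' ≫ (ρ_ X).hom := by
        rw [whisker_exchange, BraidedCategory.braiding_tensor_right_hom]; simp
    _ = _ := by rw [whiskerLeft_comp_braiding]; simp

theorem kink_right_braiding_inv (X X' : C) [ExactPairing X X'] :
    (ρ_ X).inv ≫ X ◁ η_ X X' ≫ (α_ X X X').inv ≫ (β_ X X).inv ▷ X' ≫ (α_ X X X').hom ≫
      X ◁ evL X X' ≫ (ρ_ X).hom = (twist X).inv := by
  calc _ = (ρ_ X).inv ≫ X ◁ η_ X X' ≫ (α_ X X X').inv ≫ ((β_ X X).inv ≫ X ◁ (twist X).inv) ▷ X' ≫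
        (α_ X X X').hom ≫ X ◁ ((β_ X' X).inv ≫ ε_ X X') ≫ (ρ_ X).hom := by
        rw [evL_eq]; monoidal
    _ = (ρ_ X).inv ≫ (X ◁ η_ X X' ≫ (twist X).inv ▷ _) ≫ (α_ X X X').inv ≫ ((β_ X X).inv) ▷ X' ≫
        (α_ X X X').hom ≫ X ◁ ((β_ X' X).inv ≫ ε_ X X') ≫ (ρ_ X).hom := by
        rw [← BraidedCategory.braiding_inv_naturality_left]; monoidal
    _ = (twist X).inv ≫ ((ρ_ X).inv ≫ X ◁ η_ X X' ≫ (β_ (X ⊗ X') X).inv) ≫ (α_ _ _ _).hom ≫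
        X ◁ ε_ X X' ≫ (ρ_ X).hom := by
        rw [whisker_exchange, BraidedCategory.braiding_tensor_left_inv]; simp
    _ = _ := by rw [BraidedCategory.braiding_inv_naturality_right]; simp

theorem kink_left_braiding (X X' : C) [ExactPairing X X'] :
    (λ_ X).inv ≫ coevL X X' ▷ X ≫ (α_ X' X X).hom ≫ X' ◁ (β_ X X).hom ≫ (α_ X' X X).inv ≫
      ε_ X X' ▷ X ≫ (λ_ X).hom = (twist X).hom := by
  calc _ = (λ_ X).inv ≫ (η_ X X' ≫ (β_ X X').hom) ▷ X ≫ (α_ X' X X).hom ≫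
        X' ◁ ((twist X).hom ▷ X ≫ (β_ X X).hom) ≫ (α_ X' X X).inv ≫
          ε_ X X' ▷ X ≫ (λ_ X).hom := by
        rw [coevL]; monoidal
    _ = (λ_ X).inv ≫ (η_ X X' ≫ (β_ X X').hom) ▷ X ≫ (α_ X' X X).hom ≫
        X' ◁ (β_ X X).hom ≫ (α_ X' X X).inv ≫ ((X' ⊗ X) ◁ (twist X).hom ≫
          ε_ X X' ▷ X) ≫ (λ_ X).hom := by
        rw [BraidedCategory.braiding_naturality_left]; monoidal
    _ = (λ_ X).inv ≫ η_ X X' ▷ X ≫ (α_ _ _ _).hom ≫ ((β_ X (X' ⊗ X)).hom ≫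
          ε_ X X' ▷ X) ≫ (λ_ X).hom ≫ (twist X).hom := by
        rw [whisker_exchange, BraidedCategory.braiding_tensor_right_hom]; simp
    _ = _ := by rw [← BraidedCategory.braiding_naturality_right]; simp

theorem kink_left_braiding_inv (X X' : C) [ExactPairing X X'] :
    (λ_ X).inv ≫ coevL X X' ▷ X ≫ (α_ X' X X).hom ≫ X' ◁ (β_ X X).inv ≫ (α_ X' X X).inv ≫
      ε_ X X' ▷ X ≫ (λ_ X).hom = (twist X).inv := by
  calc _ = (λ_ X).inv ≫ (η_ X X' ≫ (β_ X' X).inv) ▷ X ≫ (α_ X' X X).hom ≫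
        X' ◁ ((twist X).inv ▷ X ≫ (β_ X X).inv) ≫ (α_ X' X X).inv ≫
          ε_ X X' ▷ X ≫ (λ_ X).hom := by
        rw [coevL_eq]; monoidal
    _ = (λ_ X).inv ≫ (η_ X X' ≫ (β_ X' X).inv) ▷ X ≫ (α_ X' X X).hom ≫
        X' ◁ (β_ X X).inv ≫ (α_ X' X X).inv ≫ ((X' ⊗ X) ◁ (twist X).inv ≫
          ε_ X X' ▷ X) ≫ (λ_ X).hom := by
        rw [BraidedCategory.braiding_inv_naturality_left]; monoidal
    _ = (λ_ X).inv ≫ η_ X X' ▷ X ≫ (α_ _ _ _).hom ≫ ((β_ (X' ⊗ X) X).inv ≫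
          ε_ X X' ▷ X) ≫ (λ_ X).hom ≫ (twist X).inv := by
        rw [whisker_exchange, BraidedCategory.braiding_tensor_left_inv]; simp
    _ = _ := by rw [← BraidedCategory.braiding_inv_naturality_right]; simp

/-- The operator invariant only depends on the isotopy class of a tangle diagram. -/
theorem Tangle.Isotopic.eval_eq {ι : Type} (X : ι → C) {A B : Ob ι} {f g : Tangle ι A B}
    (h : f.Isotopic g) : f.eval X = g.eval X := by
  induction h with
  | refl f => rfl
  | symm _ ih => exact ih.symm
  | trans _ _ ih ih' => exact ih.trans ih'
  | comp _ _ ih ih' => simp only [Tangle.eval, ih, ih']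
  | tensor _ _ ih ih' => exact congrArg₂ (· ⊗ₘ ·) ih ih'
  | id_comp f => exact Category.id_comp _
  | comp_id f => exact Category.comp_id _
  | comp_assoc f g h => exact Category.assoc _ _ _
  | tensor_id A B => exact id_tensorHom_id _ _
  | interchange f g f' g' => exact (tensorHom_comp_tensorHom _ _ _ _).symm
  | assoc_inv A B C => exact Iso.hom_inv_id _
  | inv_assoc A B C => exact Iso.inv_hom_id _
  | lunit_inv A => exact Iso.hom_inv_id _
  | inv_lunit A => exact Iso.inv_hom_id _
  | runit_inv A => exact Iso.hom_inv_id _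
  | inv_runit A => exact Iso.inv_hom_id _
  | assoc_natural f g h => exact associator_naturality _ _ _
  | lunit_natural f => simp [Tangle.eval, Ob.eval]
  | runit_natural f => simp [Tangle.eval, Ob.eval]
  | pentagon A B C D => simp [Tangle.eval, Ob.eval]
  | triangle A B => simp [Tangle.eval, Ob.eval]
  | zigzag_up i => simp [Tangle.eval, Ob.eval]
  | zigzag_down i => simp [Tangle.eval, Ob.eval]
  | zagzig_down i =>
    simp only [Tangle.eval, Ob.eval, tensorHom_id, id_tensorHom]
    change _ ≫ coevL (X i) (X i)ᘁ ▷ _ ≫ _ ≫ _ ◁ evL (X i) (X i)ᘁ ≫ _ = _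
    rw [evL_coevL_comp]
    simp
  | zagzig_up i =>
    simp only [Tangle.eval, Ob.eval, tensorHom_id, id_tensorHom]
    change _ ≫ _ ◁ coevL (X i) (X i)ᘁ ≫ _ ≫ evL (X i) (X i)ᘁ ▷ _ ≫ _ = _
    rw [coevL_evL_comp]
    simp
  | cross_crossInv A B => exact Iso.hom_inv_id _
  | crossInv_cross A B => exact Iso.inv_hom_id _
  | cross_natural f g => exact BraidedCategory.braiding_naturality _ _
  | cross_tensor_right A B C => simp [Tangle.eval, Ob.eval]
  | cross_tensor_left A B C => simp [Tangle.eval, Ob.eval]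
  | kink_cross i =>
    refine Eq.trans ?_ ((kink_right_braiding (X i) (X i)ᘁ).trans
      ((kink_left_braiding (X i) (X i)ᘁ).symm.trans ?_)) <;>
    simp [Tangle.kinkLeft, Tangle.kinkRight, Tangle.eval, Ob.eval, evL, coevL]
  | kink_crossInv i =>
    refine Eq.trans ?_ ((kink_right_braiding_inv (X i) (X i)ᘁ).trans
      ((kink_left_braiding_inv (X i) (X i)ᘁ).symm.trans ?_)) <;>
    simp [Tangle.kinkLeft, Tangle.kinkRight, Tangle.eval, Ob.eval, evL, coevL]

end Invariance

/-! ### Nested minima and maxima, and the duality of a tensor product -/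

section Parallel

variable {C : Type u} [Category.{v} C] [MonoidalCategory C] [BraidedCategory C]

/-- The hexagon splits the braiding in `whiskerLeft_comp_braiding` into crossings with the two legs,
one of which is then moved to the other side. -/
theorem whiskerLeft_comp_braiding_whiskerRight (X : C) {Y Z : C} (c : 𝟙_ C ⟶ Y ⊗ Z) :
    X ◁ c ⊗≫ (β_ X Y).hom ▷ Z = 𝟙 _ ⊗≫ c ▷ X ⊗≫ Y ◁ (β_ X Z).inv ⊗≫ 𝟙 _ := by
  have h := whiskerLeft_comp_braiding (X := X) c
  rw [BraidedCategory.braiding_tensor_right_hom] at h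
  have h' : X ◁ c ≫ (α_ X Y Z).inv ≫ (β_ X Y).hom ▷ Z =
    (ρ_ X).hom ≫ ((λ_ X).inv ≫ c ▷ X) ≫ (α_ _ _ _).hom ≫ Y ◁ (β_ X Z).inv ≫ (α_ _ _ _).inv := by
    rw [← h]; simp
  calc _ = X ◁ c ≫ (α_ X Y Z).inv ≫ (β_ X Y).hom ▷ Z := by monoidal
    _ = _ := by rw [h']; monoidal

/-- A nested pair of minima, both twisted by the braiding, is obtained from a nested pair of minima
by the braiding and a full twist. -/
theorem nested_coevaluation_braiding (X X' Y Y' : C) [ExactPairing X X'] [ExactPairing Y Y'] :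
    η_ (X ⊗ Y) (Y' ⊗ X') ≫ (β_ (X ⊗ Y) (Y' ⊗ X')).hom ≫
      (Y' ⊗ X') ◁ ((β_ X Y).hom ≫ (β_ Y X).hom) =
    (η_ Y Y' ≫ (β_ Y Y').hom) ⊗≫ (Y' ◁ (η_ X X' ≫ (β_ X X').hom)) ▷ Y ⊗≫ 𝟙 _ := by
  calc _ = η_ (X ⊗ Y) (Y' ⊗ X') ≫ (β_ X Y).hom ▷ (Y' ⊗ X') ≫ (β_ (Y ⊗ X) (Y' ⊗ X')).hom ≫
        (Y' ⊗ X') ◁ (β_ Y X).hom := by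
        rw [whiskerLeft_comp, ← BraidedCategory.braiding_naturality_left_assoc]
    _ = 𝟙 _ ⊗≫ η_ X X' ⊗≫ (X ◁ η_ Y Y' ⊗≫ (β_ X Y).hom ▷ Y') ▷ X' ⊗≫
        (β_ (Y ⊗ X) (Y' ⊗ X')).hom ≫ (Y' ⊗ X') ◁ (β_ Y X).hom := by
        rw [ExactPairing.tensor_coevaluation]; monoidal
    _ = 𝟙 _ ⊗≫ η_ X X' ⊗≫ η_ Y Y' ▷ (X ⊗ X') ⊗≫ Y ◁ ((β_ X Y').inv ≫ (β_ X Y').hom) ▷ X' ⊗≫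
        (Y ⊗ Y') ◁ (β_ X X').hom ⊗≫ (β_ Y Y').hom ▷ (X' ⊗ X) ⊗≫
        Y' ◁ (β_ Y X').hom ▷ X ⊗≫ Y' ◁ X' ◁ (β_ Y X).hom ⊗≫ 𝟙 _ := by
        rw [whiskerLeft_comp_braiding_whiskerRight, BraidedCategory.braiding_tensor_left_hom,
          BraidedCategory.braiding_tensor_right_hom, BraidedCategory.braiding_tensor_right_hom]
        monoidal
    _ = 𝟙 _ ⊗≫ η_ X X' ⊗≫ (η_ Y Y' ▷ (X ⊗ X') ≫ (Y ⊗ Y') ◁ (β_ X X').hom) ⊗≫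
        (β_ Y Y').hom ▷ (X' ⊗ X) ⊗≫ Y' ◁ (β_ Y (X' ⊗ X)).hom ⊗≫ 𝟙 _ := by
        rw [Iso.inv_hom_id, BraidedCategory.braiding_tensor_right_hom]; monoidal
    _ = 𝟙 _ ⊗≫ ((𝟙_ C) ◁ (η_ X X' ≫ (β_ X X').hom) ≫ (η_ Y Y' ≫ (β_ Y Y').hom) ▷ (X' ⊗ X)) ⊗≫
        Y' ◁ (β_ Y (X' ⊗ X)).hom ⊗≫ 𝟙 _ := by
        rw [← whisker_exchange]; monoidal
    _ = 𝟙 _ ⊗≫ (η_ Y Y' ≫ (β_ Y Y').hom) ⊗≫ Y' ◁ (Y ◁ (η_ X X' ≫ (β_ X X').hom) ≫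
         (β_ Y (X' ⊗ X)).hom) ⊗≫ 𝟙 _ := by
        rw [whisker_exchange]; monoidal
    _ = _ := by
        rw [BraidedCategory.braiding_naturality_right, braiding_tensorUnit_right]
        monoidal

variable [RightRigidCategory C] [RibbonCategory C]

open RibbonCategory

/-- The double braiding in the twist of X ⊗ Y is exactly what disentangles the two minima in
`nested_coevaluation_braiding`; the two remaining twists are distributed over them. This is why a
bundle of two parallel strands behaves like one strand. -/
theorem coevL_tensor (X X' Y Y' : C) [ExactPairing X X'] [ExactPairing Y Y'] :
    coevL (X ⊗ Y) (Y' ⊗ X') = coevL Y Y' ⊗≫ (Y' ◁ coevL X X') ▷ Y ⊗≫ 𝟙 _ := by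
  have h : (twist (X ⊗ Y)).hom = (β_ X Y).hom ≫ (β_ Y X).hom ≫
      ((twist X).hom ⊗ₘ (twist Y).hom) := by
    rw [twist_tensor]; simp
  rw [coevL, h]
  calc _ = (η_ (X ⊗ Y) (Y' ⊗ X') ≫ (β_ (X ⊗ Y) (Y' ⊗ X')).hom ≫
      (Y' ⊗ X') ◁ ((β_ X Y).hom ≫ (β_ Y X).hom)) ≫ (Y' ⊗ X') ◁ ((twist X).hom ⊗ₘ (twist Y).hom) := by
        simp
    _ = (η_ Y Y' ≫ (β_ Y Y').hom) ⊗≫ ((Y' ◁ ((η_ X X' ≫ (β_ X X').hom) ≫ X' ◁ (twist X).hom)) ▷ Y ≫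
         (Y' ⊗ X' ⊗ X) ◁ (twist Y).hom) ⊗≫ 𝟙 _ := by
        rw [nested_coevaluation_braiding, MonoidalCategory.tensorHom_def]; monoidal
    _ = _ := by
        rw [← whisker_exchange, coevL, coevL]; monoidal

/-- Both sides are evaluations of exact pairings with the same coevaluation, by `coevL_tensor`. -/
theorem evL_tensor (X X' Y Y' : C) [ExactPairing X X'] [ExactPairing Y Y'] :
    evL (X ⊗ Y) (Y' ⊗ X') = 𝟙 _ ⊗≫ X ◁ (evL Y Y' ▷ X') ⊗≫ evL X X' :=
  evaluation_eq_of_coevaluation_eq (ribbonPairing (X ⊗ Y) (Y' ⊗ X'))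
    (@ExactPairing.tensor _ _ _ Y' X' Y X (ribbonPairing Y Y') (ribbonPairing X X'))
    (coevL_tensor X X' Y Y')

end Parallel

/-! ### Cabling, and the operator of a slid diagram -/

section Cable

variable {C : Type u} [Category.{v} C] [MonoidalCategory C] [BraidedCategory C]
  [RightRigidCategory C] [RibbonCategory C]

open RibbonCategory

/-- A bundle of strands, coloured by `c`, behaves as one strand coloured by `X`. -/
structure Strand.Realizes {κ : Type} (S : Strand κ) (c : κ → C) (X : C) where
  up : S.up.eval c ≅ X
  down : S.down.eval c ≅ Xᘁ
  cupUD : S.cupUD.eval c ≫ (up.hom ⊗ₘ down.hom) = η_ X Xᘁ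
  cupDU : S.cupDU.eval c ≫ (down.hom ⊗ₘ up.hom) = coevL X Xᘁ
  capDU : S.capDU.eval c = (down.hom ⊗ₘ up.hom) ≫ ε_ X Xᘁ
  capUD : S.capUD.eval c = (up.hom ⊗ₘ down.hom) ≫ evL X Xᘁ

/-- One strand realizes its colour. -/
def Strand.Realizes.single {κ : Type} (c : κ → C) (i : κ) :
    (Strand.single i).Realizes c (c i) where
  up := Iso.refl _
  down := Iso.refl _
  cupUD := (congrArg (_ ≫ ·) (id_tensorHom_id _ _)).trans (Category.comp_id _)
  cupDU := (congrArg (_ ≫ ·) (id_tensorHom_id _ _)).trans (Category.comp_id _)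
  capDU := ((congrArg (· ≫ _) (id_tensorHom_id _ _)).trans (Category.id_comp _)).symm
  capUD := ((congrArg (· ≫ _) (id_tensorHom_id _ _)).trans (Category.id_comp _)).symm

theorem eval_nestCup {κ : Type} (c : κ → C) {A A' B B' : Ob κ}
    (f : Tangle κ Ob.unit (A.tensor A')) (g : Tangle κ Ob.unit (B.tensor B')) :
    (nestCup f g).eval c =
      (show 𝟙_ C ⟶ A.eval c ⊗ A'.eval c from f.eval c) ⊗≫
        (A.eval c ◁ (show 𝟙_ C ⟶ B.eval c ⊗ B'.eval c from g.eval c)) ▷ A'.eval c ⊗≫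
          𝟙 ((A.eval c ⊗ B.eval c) ⊗ (B'.eval c ⊗ A'.eval c)) := by
  change (show 𝟙_ C ⟶ A.eval c ⊗ A'.eval c from f.eval c) ≫
    (𝟙 _ ⊗ₘ ((λ_ _).inv ≫ ((show 𝟙_ C ⟶ B.eval c ⊗ B'.eval c from g.eval c) ⊗ₘ 𝟙 _) ≫
      (α_ _ _ _).hom)) ≫ (α_ _ _ _).inv = _
  generalize (show 𝟙_ C ⟶ A.eval c ⊗ A'.eval c from f.eval c) = f
  generalize (show 𝟙_ C ⟶ B.eval c ⊗ B'.eval c from g.eval c) = g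
  rw [id_tensorHom, tensorHom_id]
  monoidal

theorem eval_nestCap {κ : Type} (c : κ → C) {A A' B B' : Ob κ}
    (f : Tangle κ (A.tensor A') Ob.unit) (g : Tangle κ (B.tensor B') Ob.unit) :
    (nestCap f g).eval c =
      𝟙 ((A.eval c ⊗ B.eval c) ⊗ (B'.eval c ⊗ A'.eval c)) ⊗≫
        A.eval c ◁ ((show B.eval c ⊗ B'.eval c ⟶ 𝟙_ C from g.eval c) ▷ A'.eval c) ⊗≫
          (show A.eval c ⊗ A'.eval c ⟶ 𝟙_ C from f.eval c) := by
  change (α_ _ _ _).hom ≫ (𝟙 _ ⊗ₘ ((α_ _ _ _).inv ≫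
    ((show B.eval c ⊗ B'.eval c ⟶ 𝟙_ C from g.eval c) ⊗ₘ 𝟙 _) ≫ (λ_ _).hom)) ≫
      (show A.eval c ⊗ A'.eval c ⟶ 𝟙_ C from f.eval c) = _
  generalize (show A.eval c ⊗ A'.eval c ⟶ 𝟙_ C from f.eval c) = f
  generalize (show B.eval c ⊗ B'.eval c ⟶ 𝟙_ C from g.eval c) = g
  rw [id_tensorHom, tensorHom_id]
  monoidal

theorem coevL_comp_rightDualIso {X Y₁ Y₂ : C} (p₁ : ExactPairing X Y₁)
    (p₂ : ExactPairing X Y₂) :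
    coevL X Y₁ ≫ (rightDualIso p₁ p₂).hom ▷ X = coevL X Y₂ := by
  rw [coevL, coevL, ← coevaluation_comp_rightDualIso p₁ p₂]
  simp [whisker_exchange]

theorem rightDualIso_comp_evL {X Y₁ Y₂ : C} (p₁ : ExactPairing X Y₁)
    (p₂ : ExactPairing X Y₂) :
    X ◁ (rightDualIso p₁ p₂).hom ≫ evL X Y₂ = evL X Y₁ := by
  rw [evL, evL, ← rightDualIso_comp_evaluation p₁ p₂, whisker_exchange_assoc]
  simp

/-- Two parallel strands realize the tensor product of their colours. -/
def Strand.Realizes.parallel {κ : Type} (c : κ → C) (i j : κ) :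
    (Strand.parallel (.single i) (.single j)).Realizes c (c i ⊗ c j) where
  up := Iso.refl _
  -- The downward bundle has the colour (c j)ᘁ ⊗ (c i)ᘁ, which is only canonically isomorphic to the
  -- chosen dual of c i ⊗ c j.
  down := rightDualIso (ExactPairing.tensor (X₁ := c i) (X₂ := c j) (Y₁ := (c i)ᘁ) (Y₂ := (c j)ᘁ))
    inferInstance
  cupUD := by
    refine Eq.trans ?_ (coevaluation_comp_rightDualIso
      (ExactPairing.tensor (X₁ := c i) (X₂ := c j) (Y₁ := (c i)ᘁ) (Y₂ := (c j)ᘁ)) inferInstance)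
    exact congrArg₂ (· ≫ ·) (eval_nestCup c (.cupUD i) (.cupUD j)) (id_tensorHom _ _)
  cupDU := by
    refine Eq.trans ?_ (coevL_comp_rightDualIso
      (ExactPairing.tensor (X₁ := c i) (X₂ := c j) (Y₁ := (c i)ᘁ) (Y₂ := (c j)ᘁ)) inferInstance)
    exact congrArg₂ (· ≫ ·) ((eval_nestCup c (.cupDU j) (.cupDU i)).trans
      (coevL_tensor (c i) (c i)ᘁ (c j) (c j)ᘁ).symm) (tensorHom_id _ _)
  capDU := by
    refine Eq.trans ?_ (congrArg (· ≫ _) (tensorHom_id _ _).symm)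
    refine Eq.trans ?_ (rightDualIso_comp_evaluation
      (ExactPairing.tensor (X₁ := c i) (X₂ := c j) (Y₁ := (c i)ᘁ) (Y₂ := (c j)ᘁ))
      inferInstance).symm
    exact eval_nestCap c (.capDU j) (.capDU i)
  capUD := by
    refine Eq.trans ?_ (congrArg (· ≫ _) (id_tensorHom _ _).symm)
    refine Eq.trans ?_ (rightDualIso_comp_evL
      (ExactPairing.tensor (X₁ := c i) (X₂ := c j) (Y₁ := (c i)ᘁ) (Y₂ := (c j)ᘁ))
      inferInstance).symm
    exact (eval_nestCap c (.capUD i) (.capUD j)).trans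
      (evL_tensor (c i) (c i)ᘁ (c j) (c j)ᘁ).symm

/-- Replacing strands by bundles of strands, on objects. -/
def Ob.cableIso {ι κ : Type} {S : ι → Strand κ} {c : κ → C} {d : ι → C}
    (h : ∀ i, (S i).Realizes c (d i)) : (A : Ob ι) → ((A.cable S).eval c ≅ A.eval d)
  | .unit => Iso.refl _
  | .up i => (h i).up
  | .down i => (h i).down
  | .tensor A B => A.cableIso h ⊗ᵢ B.cableIso h

/-- The invariant of a cable is the invariant of the diagram with the realized colours. -/
theorem Tangle.eval_cable {ι κ : Type} {S : ι → Strand κ} {c : κ → C} {d : ι → C}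
    (h : ∀ i, (S i).Realizes c (d i)) {A B : Ob ι} (f : Tangle ι A B) :
    (f.cable S).eval c ≫ (B.cableIso h).hom = (A.cableIso h).hom ≫ f.eval d := by
  induction f with
  | id A => exact (Category.id_comp _).trans (Category.comp_id _).symm
  | comp f g hf hg =>
    simp only [Tangle.cable, Tangle.eval, Category.assoc, hg, reassoc_of% hf]
  | tensor f g hf hg =>
    change (_ ⊗ₘ _) ≫ (_ ⊗ₘ _) = (_ ⊗ₘ _) ≫ (_ ⊗ₘ _)
    rw [tensorHom_comp_tensorHom, tensorHom_comp_tensorHom, hf, hg]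
  | assoc A B D => exact (associator_naturality _ _ _).symm
  | assocInv A B D => exact (associator_inv_naturality _ _ _).symm
  | lunit A =>
    change (λ_ _).hom ≫ _ = (𝟙 _ ⊗ₘ _) ≫ (λ_ _).hom
    simp
  | lunitInv A =>
    change (λ_ _).inv ≫ (𝟙 _ ⊗ₘ _) = _ ≫ (λ_ _).inv
    simp
  | runit A =>
    change (ρ_ _).hom ≫ _ = (_ ⊗ₘ 𝟙 _) ≫ (ρ_ _).hom
    simp
  | runitInv A =>
    change (ρ_ _).inv ≫ (_ ⊗ₘ 𝟙 _) = _ ≫ (ρ_ _).inv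
    simp
  | cross A B => exact (BraidedCategory.braiding_naturality _ _).symm
  | crossInv A B => exact (BraidedCategory.braiding_inv_naturality _ _).symm
  | cupUD i => exact (h i).cupUD.trans (Category.id_comp _).symm
  | cupDU i => exact (h i).cupDU.trans (Category.id_comp _).symm
  | capDU i => exact (Category.comp_id _).trans (h i).capDU
  | capUD i => exact (Category.comp_id _).trans (h i).capUD

variable {m : ℕ}

/-- The colours realized by doubling the first component. -/
def doubleFstRealizes (X : C) (r : Fin (m + 1) → C) : ∀ i : Fin (m + 2),
    (doubleFst i).Realizes (Fin.cons X r : Fin (m + 2) → C)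
      ((Fin.cons (X ⊗ r 0) r : Fin (m + 2) → C) i) :=
  Fin.cases (Strand.Realizes.parallel _ fst snd) fun j => Strand.Realizes.single _ j.succ

/-- The operator of a band between an upward strand coloured by `V` and a downward strand. -/
def bandHom (X V : C) : (X ⊗ V) ⊗ Vᘁ ⟶ (X ⊗ V) ⊗ Vᘁ :=
  (α_ _ _ _).hom ≫ X ◁ (evL V Vᘁ ≫ η_ V Vᘁ) ≫ (α_ _ _ _).inv

/-- Outside the band, the slid diagram is a cable of `P` and `Q`, so it is evaluated with the first
colour X ⊗ r 0. At the two strands of the spot the identification of the bundle with its colour is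
the identity, hence the band enters unchanged as a coupon. -/
theorem eval_slide {A B : Ob (Fin (m + 2))} (P : Tangle (Fin (m + 2)) Ob.unit (spot A B))
    (Q : Tangle (Fin (m + 2)) (spot A B) Ob.unit) (X : C) (r : Fin (m + 1) → C) :
    (slide P Q).eval (Fin.cons X r : Fin (m + 2) → C) =
      P.eval (Fin.cons (X ⊗ r 0) r : Fin (m + 2) → C) ≫
        (A.eval (Fin.cons (X ⊗ r 0) r : Fin (m + 2) → C) ◁
          (bandHom X (r 0) ▷ B.eval (Fin.cons (X ⊗ r 0) r : Fin (m + 2) → C))) ≫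
        Q.eval (Fin.cons (X ⊗ r 0) r : Fin (m + 2) → C) := by
  -- At the empty row the cabling isomorphism is the identity and disappears.
  have hP := (P.eval_cable (doubleFstRealizes X r)).trans (Category.id_comp _)
  have hQ := (Category.comp_id _).symm.trans (Q.eval_cable (doubleFstRealizes X r))
  refine comp_conj_whisker (A.cableIso (doubleFstRealizes X r)).hom
    (B.cableIso (doubleFstRealizes X r)).hom hP hQ ?_
  change (α_ _ _ _).hom ≫ (𝟙 X ⊗ₘ (evL (r 0) (r 0)ᘁ ≫ η_ (r 0) (r 0)ᘁ)) ≫ (α_ _ _ _).inv = _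
  rw [id_tensorHom, bandHom]

end Cable

/-! ### Arcs of a diagram -/

section Arcs

variable {ι : Type}

instance Ob.finite_pt (A : Ob ι) : Finite A.Pt := by
  induction A with
  | unit => exact inferInstanceAs (Finite Empty)
  | up i => exact inferInstanceAs (Finite Unit)
  | down i => exact inferInstanceAs (Finite Unit)
  | tensor A B hA hB => exact inferInstanceAs (Finite (A.Pt ⊕ B.Pt))

/-- Finiteness provides the maximal set of arcs in `Tangle.ins_eq_ins_true`. -/
instance Tangle.finite_arc {A B : Ob ι} (f : Tangle ι A B) : Finite f.Arc := by
  induction f with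
  | id A => exact inferInstanceAs (Finite A.Pt)
  | comp f g hf hg => exact inferInstanceAs (Finite (f.Arc ⊕ g.Arc))
  | tensor f g hf hg => exact inferInstanceAs (Finite (f.Arc ⊕ g.Arc))
  | assoc A B D => exact inferInstanceAs (Finite (A.Pt ⊕ (B.Pt ⊕ D.Pt)))
  | assocInv A B D => exact inferInstanceAs (Finite (A.Pt ⊕ (B.Pt ⊕ D.Pt)))
  | lunit A => exact inferInstanceAs (Finite A.Pt)
  | lunitInv A => exact inferInstanceAs (Finite A.Pt)
  | runit A => exact inferInstanceAs (Finite A.Pt)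
  | runitInv A => exact inferInstanceAs (Finite A.Pt)
  | cross A B => exact inferInstanceAs (Finite (A.Pt ⊕ B.Pt))
  | crossInv A B => exact inferInstanceAs (Finite (A.Pt ⊕ B.Pt))
  | cupUD i => exact inferInstanceAs (Finite Unit)
  | cupDU i => exact inferInstanceAs (Finite Unit)
  | capDU i => exact inferInstanceAs (Finite Unit)
  | capUD i => exact inferInstanceAs (Finite Unit)

theorem Tangle.label_top {A B : Ob ι} (f : Tangle ι A B) (p : B.Pt) :
    f.label (f.top p) = B.label p := by
  induction f with
  | id A => rfl
  | comp f g hf hg => exact hg p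
  | tensor f g hf hg => rcases p with p | p; exacts [hf p, hg p]
  | assoc A B D => rfl
  | assocInv A B D => rcases p with (p | p) | p <;> rfl
  | lunit A => rfl
  | lunitInv A => rcases p with ⟨⟨⟩⟩ | p; rfl
  | runit A => rfl
  | runitInv A => rcases p with p | ⟨⟨⟩⟩; rfl
  | cross A B => rcases p with p | p <;> rfl
  | crossInv A B => rcases p with p | p <;> rfl
  | cupUD i => rcases p with p | p <;> rfl
  | cupDU i => rcases p with p | p <;> rfl
  | capDU i => cases p
  | capUD i => cases p

open Classical in
/-- The number modulo two of the points of a row which belong to a set. -/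
noncomputable def Ob.parity : (A : Ob ι) → (A.Pt → Prop) → ZMod 2
  | .unit, _ => 0
  | .up _, S => if S () then 1 else 0
  | .down _, S => if S () then 1 else 0
  | .tensor A B, S => A.parity (fun p => S (.inl p)) + B.parity (fun p => S (.inr p))

/-- A set of arcs which is closed under gluing has as many bottom ends as top ends, modulo two. -/
theorem Tangle.parity_bot_eq_parity_top {A B : Ob ι} (f : Tangle ι A B) (S : f.Arc → Prop)
    (hS : ∀ x y, f.Glued x y → (S x ↔ S y)) :
    A.parity (fun p => S (f.bot p)) = B.parity (fun p => S (f.top p)) := by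
  induction f with
  | id A => rfl
  | comp f g hf hg =>
    refine (hf (fun x => S (.inl x)) fun x y h => hS (.inl x) (.inl y) h).trans
      (Eq.trans ?_ (hg (fun x => S (.inr x)) fun x y h => hS (.inr x) (.inr y) h))
    exact congrArg _ (funext fun p => propext (hS (.inl (f.top p)) (.inr (g.bot p)) ⟨p, rfl, rfl⟩))
  | tensor f g hf hg =>
    exact congrArg₂ (· + ·) (hf (fun x => S (.inl x)) fun x y h => hS (.inl x) (.inl y) h)
      (hg (fun x => S (.inr x)) fun x y h => hS (.inr x) (.inr y) h)
  | assoc A B D => exact add_assoc _ _ _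
  | assocInv A B D => exact (add_assoc _ _ _).symm
  | lunit A => exact zero_add _
  | lunitInv A => exact (zero_add _).symm
  | runit A => exact add_zero _
  | runitInv A => exact (add_zero _).symm
  | cross A B => exact add_comm _ _
  | crossInv A B => exact add_comm _ _
  | cupUD i => exact (CharTwo.add_self_eq_zero _).symm
  | cupDU i => exact (CharTwo.add_self_eq_zero _).symm
  | capDU i => exact CharTwo.add_self_eq_zero _
  | capUD i => exact CharTwo.add_self_eq_zero _

/-- The point `p` contributes 0 or 1 to the parity, so its membership is determined by the other
points. This recovers gluing across a coupon, where no local argument applies. -/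
theorem Ob.parity_injective (A : Ob ι) {S T : A.Pt → Prop} (p : A.Pt)
    (h : ∀ q, q ≠ p → (S q ↔ T q)) (hp : A.parity S = A.parity T) : S p ↔ T p := by
  induction A with
  | unit => cases p
  | up i =>
    cases p
    by_cases hS : S () <;> by_cases hT : T () <;> simp_all [Ob.parity]
  | down i =>
    cases p
    by_cases hS : S () <;> by_cases hT : T () <;> simp_all [Ob.parity]
  | tensor A B hA hB =>
    rcases p with p | p
    · refine hA p (fun q hq => h (.inl q) fun h => hq (Sum.inl.inj h))
        (add_right_cancel (b := B.parity fun q => S (.inr q)) (hp.trans (congrArg (_ + ·) ?_)))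
      exact congrArg _ (funext fun q => propext (h (.inr q) (by intro h; cases h)).symm)
    · refine hB p (fun q hq => h (.inr q) fun h => hq (Sum.inr.inj h))
        (add_left_cancel (a := A.parity fun q => S (.inl q)) (hp.trans (congrArg (· + _) ?_)))
      exact congrArg _ (funext fun q => propext (h (.inl q) (by intro h; cases h)).symm)

end Arcs

/-! ### Insertion of idempotents -/

section Insert

variable {C : Type u} [Category.{v} C]

open Classical in
/-- The endomorphism `f` if `s` holds, and the identity otherwise. -/
noncomputable def pick (s : Prop) {X : C} (f : X ⟶ X) : X ⟶ X := if s then f else 𝟙 X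

theorem pick_of {s : Prop} (hs : s) {X : C} (f : X ⟶ X) : pick s f = f := if_pos hs

theorem pick_of_not {s : Prop} (hs : ¬ s) {X : C} (f : X ⟶ X) : pick s f = 𝟙 X := if_neg hs

theorem pick_comp_pick {s t : Prop} {X : C} {f : X ⟶ X} (hf : f ≫ f = f) :
    pick s f ≫ pick t f = pick (s ∨ t) f := by
  by_cases hs : s <;> by_cases ht : t <;> simp [pick, hs, ht, hf]

theorem pick_comp_pick_comp_pick {s t r q : Prop} {X : C} {f : X ⟶ X} (hf : f ≫ f = f)
    (h : (s ∨ t) ∨ r ↔ q) : (pick s f ≫ pick t f) ≫ pick r f = pick q f := by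
  rw [pick_comp_pick hf, pick_comp_pick hf, h]

theorem pick_congr {s t : Prop} {X : C} {f : X ⟶ X} (h : f = 𝟙 X ∨ (s ↔ t)) :
    pick s f = pick t f := by
  rcases h with rfl | h
  · simp [pick]
  · rw [h]

variable [MonoidalCategory C]
  [RightRigidCategory C] {ι : Type} (c : ι → C) (e : ∀ i, c i ⟶ c i)

/-- Endomorphisms `e` inserted at some points of a row. -/
noncomputable def Ob.ins : (A : Ob ι) → (A.Pt → Prop) → (A.eval c ⟶ A.eval c)
  | .unit, _ => 𝟙 _
  | .up i, S => pick (S ()) (e i)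
  | .down i, S => (pick (S ()) (e i))ᘁ
  | .tensor A B, S => A.ins (fun p => S (.inl p)) ⊗ₘ B.ins (fun p => S (.inr p))

variable {c e}

theorem Ob.ins_false (A : Ob ι) : A.ins c e (fun _ => False) = 𝟙 _ := by
  induction A with
  | unit => rfl
  | up i => exact pick_of_not id _
  | down i => exact (congrArg rightAdjointMate (pick_of_not id _)).trans rightAdjointMate_id
  | tensor A B hA hB => exact (congrArg₂ (· ⊗ₘ ·) hA hB).trans (id_tensorHom_id _ _)

theorem rightAdjointMate_comp_rightAdjointMate {X Y Z : C} (f : X ⟶ Y) (g : Y ⟶ Z) :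
    gᘁ ≫ fᘁ = (f ≫ g)ᘁ := (comp_rightAdjointMate).symm

/-- Idempotence lets insertions be recorded by a set, without multiplicities. -/
theorem Ob.ins_comp_ins (he : ∀ i, e i ≫ e i = e i) (A : Ob ι) (S T : A.Pt → Prop) :
    A.ins c e S ≫ A.ins c e T = A.ins c e (fun p => S p ∨ T p) := by
  induction A with
  | unit => exact Category.id_comp _
  | up i => exact pick_comp_pick (he i)
  | down i =>
    refine (rightAdjointMate_comp_rightAdjointMate _ _).trans (congrArg rightAdjointMate ?_)
    rw [pick_comp_pick (he i)]
    congr 1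
    exact propext or_comm
  | tensor A B hA hB =>
    exact (tensorHom_comp_tensorHom _ _ _ _).trans (congrArg₂ (· ⊗ₘ ·) (hA _ _) (hB _ _))

theorem Ob.ins_congr (A : Ob ι) {S T : A.Pt → Prop}
    (h : ∀ p, e (A.label p) = 𝟙 _ ∨ (S p ↔ T p)) : A.ins c e S = A.ins c e T := by
  induction A with
  | unit => rfl
  | up i => exact pick_congr (h ())
  | down i => exact congrArg rightAdjointMate (pick_congr (h ()))
  | tensor A B hA hB =>
    exact congrArg₂ (· ⊗ₘ ·) (hA fun p => h (.inl p)) (hB fun p => h (.inr p))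

/-- Insertions on both legs of a maximum are collected on the leg where `Tangle.ins` places its
single coupon. The analogous lemmas for the other extrema serve the same purpose. -/
theorem rightAdjointMate_tensorHom_comp_evaluation {X : C} (f g k : X ⟶ X) :
    (fᘁ ⊗ₘ g) ≫ Xᘁ ◁ k ≫ ε_ X Xᘁ = Xᘁ ◁ ((g ≫ k) ≫ f) ≫ ε_ X Xᘁ := by
  rw [MonoidalCategory.tensorHom_def, Category.assoc, ← whiskerLeft_comp_assoc,
    ← whisker_exchange_assoc, rightAdjointMate_comp_evaluation, ← whiskerLeft_comp_assoc]

theorem coevaluation_comp_tensorHom_rightAdjointMate {X : C} (f g k : X ⟶ X) :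
    (η_ X Xᘁ ≫ k ▷ Xᘁ) ≫ (g ⊗ₘ fᘁ) = η_ X Xᘁ ≫ ((f ≫ k) ≫ g) ▷ Xᘁ := by
  rw [MonoidalCategory.tensorHom_def, Category.assoc, ← comp_whiskerRight_assoc,
    ← whisker_exchange, ← Category.assoc, coevaluation_comp_rightAdjointMate, Category.assoc,
    ← comp_whiskerRight, Category.assoc]

variable (c e) [BraidedCategory C] [RibbonCategory C]

/-- The invariant of a tangle with endomorphisms `e` inserted at some arcs. -/
noncomputable def Tangle.ins : {A B : Ob ι} → (f : Tangle ι A B) → (f.Arc → Prop) →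
    (A.eval c ⟶ B.eval c)
  | _, _, .id A, S => A.ins c e S
  | _, _, .comp f g, S => f.ins (fun x => S (.inl x)) ≫ g.ins (fun x => S (.inr x))
  | _, _, .tensor f g, S => f.ins (fun x => S (.inl x)) ⊗ₘ g.ins (fun x => S (.inr x))
  | _, _, .assoc A B D, S => (α_ _ _ _).hom ≫ (A.tensor (B.tensor D)).ins c e S
  | _, _, .assocInv A B D, S => (A.tensor (B.tensor D)).ins c e S ≫ (α_ _ _ _).inv
  | _, _, .lunit A, S => (λ_ _).hom ≫ A.ins c e S
  | _, _, .lunitInv A, S => A.ins c e S ≫ (λ_ _).inv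
  | _, _, .runit A, S => (ρ_ _).hom ≫ A.ins c e S
  | _, _, .runitInv A, S => A.ins c e S ≫ (ρ_ _).inv
  | _, _, .cross A B, S => (A.tensor B).ins c e S ≫ (β_ (A.eval c) (B.eval c)).hom
  | _, _, .crossInv A B, S => (A.tensor B).ins c e S ≫ (β_ (B.eval c) (A.eval c)).inv
  | _, _, .cupUD i, S => η_ (c i) (c i)ᘁ ≫ pick (S ()) (e i) ▷ (c i)ᘁ
  | _, _, .cupDU i, S => coevL (c i) (c i)ᘁ ≫ (c i)ᘁ ◁ pick (S ()) (e i)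
  | _, _, .capDU i, S => (c i)ᘁ ◁ pick (S ()) (e i) ≫ ε_ (c i) (c i)ᘁ
  | _, _, .capUD i, S => pick (S ()) (e i) ▷ (c i)ᘁ ≫ evL (c i) (c i)ᘁ

variable {c e}

theorem Tangle.ins_false {A B : Ob ι} (f : Tangle ι A B) :
    f.ins c e (fun _ => False) = f.eval c := by
  induction f with
  | id A => exact A.ins_false
  | comp f g hf hg => exact congrArg₂ (· ≫ ·) hf hg
  | tensor f g hf hg => exact congrArg₂ (· ⊗ₘ ·) hf hg
  | assoc A B D => exact (congrArg _ (Ob.ins_false _)).trans (Category.comp_id _)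
  | assocInv A B D => exact (congrArg (· ≫ _) (Ob.ins_false _)).trans (Category.id_comp _)
  | lunit A => exact (congrArg _ (Ob.ins_false _)).trans (Category.comp_id _)
  | lunitInv A => exact (congrArg (· ≫ _) (Ob.ins_false _)).trans (Category.id_comp _)
  | runit A => exact (congrArg _ (Ob.ins_false _)).trans (Category.comp_id _)
  | runitInv A => exact (congrArg (· ≫ _) (Ob.ins_false _)).trans (Category.id_comp _)
  | cross A B => exact (congrArg (· ≫ _) (Ob.ins_false _)).trans (Category.id_comp _)
  | crossInv A B => exact (congrArg (· ≫ _) (Ob.ins_false _)).trans (Category.id_comp _)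
  | cupUD i =>
    exact (congrArg (fun g => η_ (c i) (c i)ᘁ ≫ g ▷ (c i)ᘁ) (pick_of_not not_false (e i))).trans
      (show η_ (c i) (c i)ᘁ ≫ 𝟙 _ ▷ _ = η_ (c i) (c i)ᘁ by simp)
  | cupDU i =>
    exact (congrArg (fun g => coevL (c i) (c i)ᘁ ≫ (c i)ᘁ ◁ g)
      (pick_of_not not_false (e i))).trans (show coevL (c i) (c i)ᘁ ≫ _ ◁ 𝟙 _ = coevL (c i) (c i)ᘁ by simp)
  | capDU i =>
    exact (congrArg (fun g => (c i)ᘁ ◁ g ≫ ε_ (c i) (c i)ᘁ) (pick_of_not not_false (e i))).trans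
      (show _ ◁ 𝟙 _ ≫ ε_ (c i) (c i)ᘁ = ε_ (c i) (c i)ᘁ by simp)
  | capUD i =>
    exact (congrArg (fun g => g ▷ (c i)ᘁ ≫ evL (c i) (c i)ᘁ) (pick_of_not not_false (e i))).trans
      (show 𝟙 _ ▷ _ ≫ evL (c i) (c i)ᘁ = evL (c i) (c i)ᘁ by simp)

theorem coevL_comp_rightAdjointMate {X Y : C} (f : X ⟶ Y) :
    coevL Y Yᘁ ≫ fᘁ ▷ Y = coevL X Xᘁ ≫ Xᘁ ◁ f := by
  have h := coevaluation_comp_rightAdjointMate f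
  simp only [coevL, Category.assoc, ← whiskerLeft_comp, ← RibbonCategory.twist_natural]
  rw [whisker_exchange, ← BraidedCategory.braiding_naturality_right_assoc, reassoc_of% h,
    BraidedCategory.braiding_naturality_left_assoc, whiskerLeft_comp]

theorem rightAdjointMate_comp_evL {X Y : C} (f : X ⟶ Y) :
    X ◁ fᘁ ≫ evL X Xᘁ = f ▷ Yᘁ ≫ evL Y Yᘁ := by
  have h := rightAdjointMate_comp_evaluation f
  simp only [evL]
  rw [← comp_whiskerRight_assoc, RibbonCategory.twist_natural, whisker_exchange_assoc,
    BraidedCategory.braiding_naturality_right_assoc, h, comp_whiskerRight_assoc,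
    BraidedCategory.braiding_naturality_left_assoc, BraidedCategory.braiding_naturality_left_assoc]
  simp

theorem tensorHom_rightAdjointMate_comp_evL {X : C} (f g k : X ⟶ X) :
    (g ⊗ₘ fᘁ) ≫ k ▷ Xᘁ ≫ evL X Xᘁ = ((g ≫ k) ≫ f) ▷ Xᘁ ≫ evL X Xᘁ := by
  rw [MonoidalCategory.tensorHom_def', Category.assoc, ← comp_whiskerRight_assoc,
    whisker_exchange_assoc, rightAdjointMate_comp_evL, ← comp_whiskerRight_assoc]

theorem coevL_comp_rightAdjointMate_tensorHom {X : C} (f g k : X ⟶ X) :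
    (coevL X Xᘁ ≫ Xᘁ ◁ k) ≫ (fᘁ ⊗ₘ g) = coevL X Xᘁ ≫ Xᘁ ◁ ((f ≫ k) ≫ g) := by
  rw [MonoidalCategory.tensorHom_def', Category.assoc, ← whiskerLeft_comp_assoc,
    whisker_exchange, ← Category.assoc, coevL_comp_rightAdjointMate, Category.assoc,
    ← whiskerLeft_comp, Category.assoc]

theorem or_image_id {α : Type*} {S T : α → Prop} {x : α} :
    T x ∨ S x ↔ S x ∨ ∃ p, T p ∧ p = x := by
  simp [or_comm]

theorem or_image_empty {α β : Type*} [IsEmpty α] {S : β → Prop} {T : α → Prop} {φ : α → β} :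
    S = fun x => S x ∨ ∃ p, T p ∧ φ p = x := by
  simp

theorem or_image_sum {T : Unit ⊕ Unit → Prop} {S : Prop} :
    (T (.inr ()) ∨ S) ∨ T (.inl ()) ↔ S ∨ ∃ p, T p ∧ () = () := by
  simp only [and_true, Sum.exists, Unique.exists_iff, PUnit.default_eq_unit]
  tauto

theorem or_image_sum' {T : Unit ⊕ Unit → Prop} {S : Prop} :
    (T (.inl ()) ∨ S) ∨ T (.inr ()) ↔ S ∨ ∃ p, T p ∧ () = () := by
  simp only [and_true, Sum.exists, Unique.exists_iff, PUnit.default_eq_unit]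
  tauto

theorem or_image_id' {α : Type*} {S T : α → Prop} {x : α} :
    S x ∨ T x ↔ S x ∨ ∃ p, T p ∧ p = x := by
  simp

/-- Endomorphisms below a tangle are absorbed by the arcs which start there. -/
theorem Tangle.ins_bot (he : ∀ i, e i ≫ e i = e i) {A B : Ob ι} (f : Tangle ι A B)
    (T : A.Pt → Prop) (S : f.Arc → Prop) :
    A.ins c e T ≫ f.ins c e S = f.ins c e (fun x => S x ∨ ∃ p, T p ∧ f.bot p = x) := by
  induction f with
  | id A =>
    refine (Ob.ins_comp_ins he _ _ _).trans (congrArg _ (funext fun x => propext ?_))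
    exact or_image_id
  | comp f g hf hg =>
    refine ((Category.assoc _ _ _).symm.trans (congrArg (· ≫ _) (hf T _))).trans
      (congrArg₂ (· ≫ ·) (congrArg _ (funext fun x => ?_)) (congrArg _ (funext fun x => ?_)))
    · exact propext (or_congr_right (exists_congr fun p => and_congr_right' Sum.inl_injective.eq_iff.symm))
    · exact propext (or_iff_left (by rintro ⟨p, -, h⟩; cases h)).symm
  | tensor f g hf hg =>
    refine ((tensorHom_comp_tensorHom _ _ _ _).trans (congrArg₂ (· ⊗ₘ ·) (hf _ _) (hg _ _))).trans
      (congrArg₂ (· ⊗ₘ ·) (congrArg _ (funext fun x => ?_)) (congrArg _ (funext fun x => ?_)))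
    · refine propext (or_congr_right ⟨?_, ?_⟩)
      · rintro ⟨p, hp, rfl⟩
        exact ⟨.inl p, hp, rfl⟩
      · rintro ⟨p | p, hp, h⟩
        · exact ⟨p, hp, Sum.inl.inj h⟩
        · cases h
    · refine propext (or_congr_right ⟨?_, ?_⟩)
      · rintro ⟨p, hp, rfl⟩
        exact ⟨.inr p, hp, rfl⟩
      · rintro ⟨p | p, hp, h⟩
        · cases h
        · exact ⟨p, hp, Sum.inr.inj h⟩
  | assoc A B D =>
    refine ((associator_naturality_assoc _ _ _ _).trans (congrArg _
      (Ob.ins_comp_ins he (A.tensor (B.tensor D))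
        (fun q => T ((Equiv.sumAssoc A.Pt B.Pt D.Pt).symm q)) S))).trans
      (congrArg (fun S => _ ≫ (A.tensor (B.tensor D)).ins c e S) (funext fun x => propext ?_))
    refine or_comm.trans (or_congr_right ⟨fun h => ⟨_, h, Equiv.apply_symm_apply _ _⟩, ?_⟩)
    rintro ⟨p, hp, rfl⟩
    exact (Equiv.symm_apply_apply (Equiv.sumAssoc A.Pt B.Pt D.Pt) p).symm ▸ hp
  | assocInv A B D =>
    refine (Category.assoc _ _ _).symm.trans (congrArg (· ≫ _) ((Ob.ins_comp_ins he _ _ _).trans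
      (congrArg _ (funext fun x => propext ?_))))
    exact or_image_id
  | lunit A =>
    refine (show (𝟙 (𝟙_ C) ⊗ₘ A.ins c e fun p => T (.inr p)) ≫ (λ_ _).hom ≫ A.ins c e S =
      (λ_ _).hom ≫ (A.ins c e fun p => T (.inr p)) ≫ A.ins c e S by simp).trans
      (congrArg _ ((Ob.ins_comp_ins he _ _ _).trans (congrArg _ (funext fun x => propext ?_))))
    refine or_comm.trans (or_congr_right ⟨fun h => ⟨.inr x, h, rfl⟩, ?_⟩)
    rintro ⟨⟨⟨⟩⟩ | p, hp, rfl⟩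
    exact hp
  | lunitInv A =>
    refine (Category.assoc _ _ _).symm.trans (congrArg (· ≫ _) ((Ob.ins_comp_ins he _ _ _).trans
      (congrArg _ (funext fun x => propext ?_))))
    exact or_image_id
  | runit A =>
    refine (show ((A.ins c e fun p => T (.inl p)) ⊗ₘ 𝟙 (𝟙_ C)) ≫ (ρ_ _).hom ≫ A.ins c e S =
      (ρ_ _).hom ≫ (A.ins c e fun p => T (.inl p)) ≫ A.ins c e S by simp).trans
      (congrArg _ ((Ob.ins_comp_ins he _ _ _).trans (congrArg _ (funext fun x => propext ?_))))
    refine or_comm.trans (or_congr_right ⟨fun h => ⟨.inl x, h, rfl⟩, ?_⟩)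
    rintro ⟨p | ⟨⟨⟩⟩, hp, rfl⟩
    exact hp
  | runitInv A =>
    refine (Category.assoc _ _ _).symm.trans (congrArg (· ≫ _) ((Ob.ins_comp_ins he _ _ _).trans
      (congrArg _ (funext fun x => propext ?_))))
    exact or_image_id
  | cross A B =>
    refine (Category.assoc _ _ _).symm.trans (congrArg (· ≫ _) ((Ob.ins_comp_ins he _ _ _).trans
      (congrArg _ (funext fun x => propext ?_))))
    exact or_image_id
  | crossInv A B =>
    refine (Category.assoc _ _ _).symm.trans (congrArg (· ≫ _) ((Ob.ins_comp_ins he _ _ _).trans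
      (congrArg _ (funext fun x => propext ?_))))
    exact or_image_id
  | cupUD i =>
    exact (Category.id_comp _).trans (congrArg _ (or_image_empty (α := Empty) (T := T)))
  | cupDU i =>
    exact (Category.id_comp _).trans (congrArg _ (or_image_empty (α := Empty) (T := T)))
  | capDU i =>
    refine (rightAdjointMate_tensorHom_comp_evaluation _ _ _).trans
      (congrArg (fun g => (c i)ᘁ ◁ g ≫ ε_ (c i) (c i)ᘁ) ?_)
    exact pick_comp_pick_comp_pick (he i) or_image_sum
  | capUD i =>
    refine (tensorHom_rightAdjointMate_comp_evL _ _ _).trans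
      (congrArg (fun g => g ▷ (c i)ᘁ ≫ evL (c i) (c i)ᘁ) ?_)
    exact pick_comp_pick_comp_pick (he i) or_image_sum'

/-- Endomorphisms above a tangle are absorbed by the arcs which end there. -/
theorem Tangle.ins_top (he : ∀ i, e i ≫ e i = e i) {A B : Ob ι} (f : Tangle ι A B)
    (T : B.Pt → Prop) (S : f.Arc → Prop) :
    f.ins c e S ≫ B.ins c e T = f.ins c e (fun x => S x ∨ ∃ p, T p ∧ f.top p = x) := by
  induction f with
  | id A =>
    exact (Ob.ins_comp_ins he _ _ _).trans (congrArg _ (funext fun x => propext or_image_id'))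
  | comp f g hf hg =>
    refine ((Category.assoc _ _ _).trans (congrArg (_ ≫ ·) (hg T _))).trans
      (congrArg₂ (· ≫ ·) (congrArg _ (funext fun x => ?_)) (congrArg _ (funext fun x => ?_)))
    · exact propext (or_iff_left (by rintro ⟨p, -, h⟩; cases h)).symm
    · exact propext (or_congr_right (exists_congr fun p => and_congr_right'
        Sum.inr_injective.eq_iff.symm))
  | tensor f g hf hg =>
    refine ((tensorHom_comp_tensorHom _ _ _ _).trans (congrArg₂ (· ⊗ₘ ·) (hf _ _) (hg _ _))).trans
      (congrArg₂ (· ⊗ₘ ·) (congrArg _ (funext fun x => ?_)) (congrArg _ (funext fun x => ?_)))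
    · refine propext (or_congr_right ⟨?_, ?_⟩)
      · rintro ⟨p, hp, rfl⟩
        exact ⟨.inl p, hp, rfl⟩
      · rintro ⟨p | p, hp, h⟩
        · exact ⟨p, hp, Sum.inl.inj h⟩
        · cases h
    · refine propext (or_congr_right ⟨?_, ?_⟩)
      · rintro ⟨p, hp, rfl⟩
        exact ⟨.inr p, hp, rfl⟩
      · rintro ⟨p | p, hp, h⟩
        · cases h
        · exact ⟨p, hp, Sum.inr.inj h⟩
  | assoc A B D =>
    exact (Category.assoc _ _ _).trans (congrArg (_ ≫ ·) ((Ob.ins_comp_ins he _ _ _).trans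
      (congrArg _ (funext fun x => propext or_image_id'))))
  | assocInv A B D =>
    refine ((Category.assoc _ _ _).trans (congrArg (_ ≫ ·)
      (associator_inv_naturality _ _ _).symm)).trans ((Category.assoc _ _ _).symm.trans
      (congrArg (· ≫ (α_ _ _ _).inv) ((Ob.ins_comp_ins he (A.tensor (B.tensor D)) S
        (fun q => T ((Equiv.sumAssoc A.Pt B.Pt D.Pt).symm q))).trans
        (congrArg (fun S => (A.tensor (B.tensor D)).ins c e S) (funext fun x => propext ?_)))))
    refine or_congr_right ⟨fun h => ⟨_, h, Equiv.apply_symm_apply _ _⟩, ?_⟩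
    rintro ⟨p, hp, rfl⟩
    exact (Equiv.symm_apply_apply (Equiv.sumAssoc A.Pt B.Pt D.Pt) p).symm ▸ hp
  | lunit A =>
    exact (Category.assoc _ _ _).trans (congrArg (_ ≫ ·) ((Ob.ins_comp_ins he _ _ _).trans
      (congrArg _ (funext fun x => propext or_image_id'))))
  | lunitInv A =>
    refine (show (A.ins c e S ≫ (λ_ _).inv) ≫ (𝟙 (𝟙_ C) ⊗ₘ A.ins c e fun p => T (.inr p)) =
      (A.ins c e S ≫ A.ins c e fun p => T (.inr p)) ≫ (λ_ _).inv by simp).trans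
      (congrArg (· ≫ _) ((Ob.ins_comp_ins he _ _ _).trans
        (congrArg _ (funext fun x => propext ?_))))
    refine or_congr_right ⟨fun h => ⟨.inr x, h, rfl⟩, ?_⟩
    rintro ⟨⟨⟨⟩⟩ | p, hp, rfl⟩
    exact hp
  | runit A =>
    exact (Category.assoc _ _ _).trans (congrArg (_ ≫ ·) ((Ob.ins_comp_ins he _ _ _).trans
      (congrArg _ (funext fun x => propext or_image_id'))))
  | runitInv A =>
    refine (show (A.ins c e S ≫ (ρ_ _).inv) ≫ ((A.ins c e fun p => T (.inl p)) ⊗ₘ 𝟙 (𝟙_ C)) =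
      (A.ins c e S ≫ A.ins c e fun p => T (.inl p)) ≫ (ρ_ _).inv by simp).trans
      (congrArg (· ≫ _) ((Ob.ins_comp_ins he _ _ _).trans
        (congrArg _ (funext fun x => propext ?_))))
    refine or_congr_right ⟨fun h => ⟨.inl x, h, rfl⟩, ?_⟩
    rintro ⟨p | ⟨⟨⟩⟩, hp, rfl⟩
    exact hp
  | cross A B =>
    refine ((Category.assoc _ _ _).trans (congrArg (_ ≫ ·)
      (BraidedCategory.braiding_naturality _ _).symm)).trans ((Category.assoc _ _ _).symm.trans
      (congrArg (· ≫ _) ((Ob.ins_comp_ins he (A.tensor B) S (fun q => T q.swap)).trans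
        (congrArg (fun S => (A.tensor B).ins c e S) (funext fun x => propext ?_)))))
    refine or_congr_right ⟨fun h => ⟨_, h, Sum.swap_swap _⟩, ?_⟩
    rintro ⟨p, hp, rfl⟩
    exact (Sum.swap_swap p).symm ▸ hp
  | crossInv A B =>
    refine ((Category.assoc _ _ _).trans (congrArg (_ ≫ ·)
      (BraidedCategory.braiding_inv_naturality _ _).symm)).trans ((Category.assoc _ _ _).symm.trans
      (congrArg (· ≫ _) ((Ob.ins_comp_ins he (A.tensor B) S (fun q => T q.swap)).trans
        (congrArg (fun S => (A.tensor B).ins c e S) (funext fun x => propext ?_)))))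
    refine or_congr_right ⟨fun h => ⟨_, h, Sum.swap_swap _⟩, ?_⟩
    rintro ⟨p, hp, rfl⟩
    exact (Sum.swap_swap p).symm ▸ hp
  | cupUD i =>
    exact (coevaluation_comp_tensorHom_rightAdjointMate _ _ _).trans
      (congrArg (fun g => η_ (c i) (c i)ᘁ ≫ g ▷ (c i)ᘁ)
        (pick_comp_pick_comp_pick (he i) or_image_sum))
  | cupDU i =>
    exact (coevL_comp_rightAdjointMate_tensorHom _ _ _).trans
      (congrArg (fun g => coevL (c i) (c i)ᘁ ≫ (c i)ᘁ ◁ g)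
        (pick_comp_pick_comp_pick (he i) or_image_sum'))
  | capDU i =>
    exact (Category.comp_id _).trans (congrArg _ (or_image_empty (α := Empty) (T := T)))
  | capUD i =>
    exact (Category.comp_id _).trans (congrArg _ (or_image_empty (α := Empty) (T := T)))

/-- If an endomorphism is inserted at one of two arcs which meet at `p`, it can be inserted at
both; `N` is a coupon which does not involve `p`. -/
theorem Tangle.ins_comp_ins_across (he : ∀ i, e i ≫ e i = e i) {A B D : Ob ι}
    (f : Tangle ι A B) (g : Tangle ι B D) (N : B.eval c ⟶ B.eval c) (S : f.Arc → Prop)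
    (T : g.Arc → Prop) (p : B.Pt)
    (hN : B.ins c e (fun q => q = p) ≫ N = N ≫ B.ins c e (fun q => q = p))
    (h : S (f.top p) ∨ T (g.bot p)) :
    f.ins c e S ≫ N ≫ g.ins c e T =
      f.ins c e (fun z => S z ∨ z = f.top p) ≫ N ≫ g.ins c e (fun z => T z ∨ z = g.bot p) := by
  have hf : f.ins c e (fun z => S z ∨ z = f.top p) = f.ins c e S ≫ B.ins c e (fun q => q = p) := by
    rw [Tangle.ins_top he]
    simp [eq_comm]
  have hg : g.ins c e (fun z => T z ∨ z = g.bot p) = B.ins c e (fun q => q = p) ≫ g.ins c e T := by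
    rw [Tangle.ins_bot he]
    simp [eq_comm]
  have hI : B.ins c e (fun q => q = p) ≫ B.ins c e (fun q => q = p) =
      B.ins c e (fun q => q = p) := by
    rw [Ob.ins_comp_ins he]; simp
  -- On the side where the idempotent is already present it can be doubled, and the extra copy
  -- passes through `N` to the other side.
  rcases h with h | h
  · have hS : (fun z => S z ∨ z = f.top p) = S :=
      funext fun z => propext (or_iff_left_of_imp (by rintro rfl; exact h))
    rw [hS] at hf ⊢
    rw [hg, hf]
    simp only [Category.assoc]
    rw [reassoc_of% hN, reassoc_of% hN, reassoc_of% hI]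
  · have hT : (fun z => T z ∨ z = g.bot p) = T :=
      funext fun z => propext (or_iff_left_of_imp (by rintro rfl; exact h))
    rw [hT] at hg ⊢
    rw [hf, hg]
    simp only [Category.assoc]
    rw [reassoc_of% hN, reassoc_of% hI]

/-- If an endomorphism is inserted at one of two neighbouring arcs, it can be inserted at both. -/
theorem Tangle.ins_glued (he : ∀ i, e i ≫ e i = e i) {A B : Ob ι} (f : Tangle ι A B)
    (S : f.Arc → Prop) {x y : f.Arc} (hxy : f.Glued x y) (h : S x ∨ S y) :
    f.ins c e S = f.ins c e (fun z => S z ∨ z = x ∨ z = y) := by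
  induction f with
  | comp f g hf hg =>
    rcases x with x | x <;> rcases y with y | y
    · refine congrArg₂ (· ≫ ·) ((hf _ hxy h).trans (congrArg _ (funext fun z => propext ?_)))
        (congrArg _ (funext fun z => propext ?_))
      · exact or_congr_right (or_congr Sum.inl_injective.eq_iff.symm Sum.inl_injective.eq_iff.symm)
      · exact (or_iff_left (by rintro (h | h) <;> cases h)).symm
    · obtain ⟨p, rfl, rfl⟩ := hxy
      have key := Tangle.ins_comp_ins_across he f g (𝟙 _) (fun z => S (.inl z))
        (fun z => S (.inr z)) p (by simp) h
      rw [Category.id_comp, Category.id_comp] at key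
      refine key.trans (congrArg₂ (· ≫ ·) (congrArg _ (funext fun z => propext ?_))
        (congrArg _ (funext fun z => propext ?_)))
      · exact or_congr_right ((or_iff_left (by intro h; cases h)).trans
          Sum.inl_injective.eq_iff).symm
      · exact or_congr_right ((or_iff_right (by intro h; cases h)).trans
          Sum.inr_injective.eq_iff).symm
    · exact hxy.elim
    · refine congrArg₂ (· ≫ ·) (congrArg _ (funext fun z => propext ?_))
        ((hg _ hxy h).trans (congrArg _ (funext fun z => propext ?_)))
      · exact (or_iff_left (by rintro (h | h) <;> cases h)).symm
      · exact or_congr_right (or_congr Sum.inr_injective.eq_iff.symm Sum.inr_injective.eq_iff.symm)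
  | tensor f g hf hg =>
    rcases x with x | x <;> rcases y with y | y
    · refine congrArg₂ (· ⊗ₘ ·) ((hf _ hxy h).trans (congrArg _ (funext fun z => propext ?_)))
        (congrArg _ (funext fun z => propext ?_))
      · exact or_congr_right (or_congr Sum.inl_injective.eq_iff.symm Sum.inl_injective.eq_iff.symm)
      · exact (or_iff_left (by rintro (h | h) <;> cases h)).symm
    · exact hxy.elim
    · exact hxy.elim
    · refine congrArg₂ (· ⊗ₘ ·) (congrArg _ (funext fun z => propext ?_))
        ((hg _ hxy h).trans (congrArg _ (funext fun z => propext ?_)))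
      · exact (or_iff_left (by rintro (h | h) <;> cases h)).symm
      · exact or_congr_right (or_congr Sum.inr_injective.eq_iff.symm Sum.inr_injective.eq_iff.symm)
  | _ => exact hxy.elim

theorem Tangle.ins_congr {A B : Ob ι} (f : Tangle ι A B) {S T : f.Arc → Prop}
    (h : ∀ x, e (f.label x) = 𝟙 _ ∨ (S x ↔ T x)) : f.ins c e S = f.ins c e T := by
  induction f with
  | id A => exact A.ins_congr h
  | comp f g hf hg =>
    exact congrArg₂ (· ≫ ·) (hf fun x => h (.inl x)) (hg fun x => h (.inr x))
  | tensor f g hf hg =>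
    exact congrArg₂ (· ⊗ₘ ·) (hf fun x => h (.inl x)) (hg fun x => h (.inr x))
  | assoc A B D => exact congrArg (_ ≫ ·) (Ob.ins_congr _ h)
  | assocInv A B D => exact congrArg (· ≫ _) (Ob.ins_congr _ h)
  | lunit A => exact congrArg (_ ≫ ·) (Ob.ins_congr _ h)
  | lunitInv A => exact congrArg (· ≫ _) (Ob.ins_congr _ h)
  | runit A => exact congrArg (_ ≫ ·) (Ob.ins_congr _ h)
  | runitInv A => exact congrArg (· ≫ _) (Ob.ins_congr _ h)
  | cross A B => exact congrArg (· ≫ _) (Ob.ins_congr (A.tensor B) h)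
  | crossInv A B => exact congrArg (· ≫ _) (Ob.ins_congr (A.tensor B) h)
  | cupUD i => exact congrArg (fun g => _ ≫ g ▷ _) (pick_congr (h ()))
  | cupDU i => exact congrArg (fun g => _ ≫ _ ◁ g) (pick_congr (h ()))
  | capDU i => exact congrArg (fun g => _ ◁ g ≫ _) (pick_congr (h ()))
  | capUD i => exact congrArg (fun g => g ▷ _ ≫ _) (pick_congr (h ()))

/-- In the closed diagram `P.comp Q` with a coupon `N` at the point `p₀`, an idempotent inserted
below the coupon spreads over the component of `p₀`. -/
theorem Tangle.ins_eq_ins_true (he : ∀ i, e i ≫ e i = e i) {D : Ob ι}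
    (P : Tangle ι Ob.unit D) (Q : Tangle ι D Ob.unit) (p₀ : D.Pt)
    (hconn : ∀ x y, (P.comp Q).label x = D.label p₀ → (P.comp Q).label y = D.label p₀ →
      Relation.EqvGen (P.comp Q).Glued x y)
    (he' : ∀ i, i ≠ D.label p₀ → e i = 𝟙 _) (N : D.eval c ⟶ D.eval c)
    (hN : ∀ p, p ≠ p₀ →
      D.ins c e (fun q => q = p) ≫ N = N ≫ D.ins c e (fun q => q = p))
    (S : P.Arc → Prop) (T : Q.Arc → Prop) (hS : S (P.top p₀)) :
    P.ins c e S ≫ N ≫ Q.ins c e T =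
      P.ins c e (fun _ => True) ≫ N ≫ Q.ins c e (fun _ => True) := by
  -- The value of the closed diagram as a function of the set of arcs carrying the idempotent. A
  -- maximal set with the given value, containing the initial one, is closed under every gluing that
  -- preserves the value.
  let val (R : Set (P.Arc ⊕ Q.Arc)) : Ob.unit.eval c ⟶ Ob.unit.eval c :=
    P.ins c e (fun x => .inl x ∈ R) ≫ N ≫ Q.ins c e (fun x => .inr x ∈ R)
  let R₀ : Set (P.Arc ⊕ Q.Arc) := {x | Sum.elim S T x}
  obtain ⟨R, hR₀, hR⟩ := (Set.toFinite {R | val R = val R₀}).exists_le_maximal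
    (a := R₀) rfl
  have hmax : ∀ x y, val (R ∪ {x, y}) = val R → x ∈ R ∧ y ∈ R := fun x y h => by
    have := hR.2 (y := R ∪ {x, y}) (h.trans hR.1) Set.subset_union_left
    exact ⟨this (by simp), this (by simp)⟩
  have closed_iff : ∀ x y, (x ∈ R ∨ y ∈ R → val (R ∪ {x, y}) = val R) → (x ∈ R ↔ y ∈ R) :=
    fun x y h => ⟨fun hx => (hmax x y (h (.inl hx))).2, fun hy => (hmax x y (h (.inr hy))).1⟩
  have hP : ∀ x y, P.Glued x y → ((.inl x ∈ R) ↔ (.inl y ∈ R)) := fun x y hxy => by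
    refine closed_iff _ _ fun h => ?_
    simp only [val]
    rw [Tangle.ins_glued he P (fun x => .inl x ∈ R) hxy h]
    simp only [Set.mem_union, Set.mem_insert_iff, Set.mem_singleton_iff, Sum.inl.injEq,
      reduceCtorEq, or_false]
  have hQ : ∀ x y, Q.Glued x y → ((.inr x ∈ R) ↔ (.inr y ∈ R)) := fun x y hxy => by
    refine closed_iff _ _ fun h => ?_
    simp only [val]
    rw [Tangle.ins_glued he Q (fun x => .inr x ∈ R) hxy h]
    simp only [Set.mem_union, Set.mem_insert_iff, Set.mem_singleton_iff, Sum.inr.injEq,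
      reduceCtorEq, or_false]
  have hPQ : ∀ p, p ≠ p₀ → ((.inl (P.top p) ∈ R) ↔ (.inr (Q.bot p) ∈ R)) := fun p hp => by
    refine closed_iff _ _ fun h => ?_
    simp only [val]
    rw [Tangle.ins_comp_ins_across he P Q N (fun x => .inl x ∈ R) (fun x => .inr x ∈ R) p
      (hN p hp) h]
    simp only [Set.mem_union, Set.mem_insert_iff, Set.mem_singleton_iff, Sum.inl.injEq,
      Sum.inr.injEq, reduceCtorEq, or_false, false_or]
  -- The coupon blocks the direct passage at p₀. But `R` is closed under gluing inside `P` and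
  -- inside `Q`, whose outer rows are empty, so it meets the middle row in an even number of points
  -- from either side. The two traces agree away from p₀, hence also at p₀: the idempotent arrives
  -- there the other way around the component.
  have hPQ₀ : (.inl (P.top p₀) ∈ R) ↔ (.inr (Q.bot p₀) ∈ R) :=
    D.parity_injective p₀ (S := fun p => .inl (P.top p) ∈ R) (T := fun p => .inr (Q.bot p) ∈ R) hPQ
      ((P.parity_bot_eq_parity_top (fun x => .inl x ∈ R) hP).symm.trans
        (Q.parity_bot_eq_parity_top (fun x => .inr x ∈ R) hQ).symm)
  have hglue : ∀ x y : P.Arc ⊕ Q.Arc, (P.comp Q).Glued x y → (x ∈ R ↔ y ∈ R) := by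
    rintro (x | x) (y | y) h
    · exact hP x y h
    · obtain ⟨p, rfl, rfl⟩ := h
      by_cases hp : p = p₀
      · exact hp ▸ hPQ₀
      · exact hPQ p hp
    · exact h.elim
    · exact hQ x y h
  have heqv : ∀ x y : P.Arc ⊕ Q.Arc, Relation.EqvGen (P.comp Q).Glued x y → (x ∈ R ↔ y ∈ R) := by
    intro x y h
    induction h with
    | rel x y h => exact hglue x y h
    | refl x => exact Iff.rfl
    | symm x y _ ih => exact ih.symm
    | trans x y z _ _ ih ih' => exact ih.trans ih'
  have hall : ∀ x : P.Arc ⊕ Q.Arc, (P.comp Q).label x = D.label p₀ → x ∈ R := fun x hx =>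
    (heqv (.inl (P.top p₀)) x (hconn _ _ (P.label_top p₀) hx)).1 (hR₀ hS)
  have h1 : val R₀ = val R := hR.1.symm
  -- On the remaining components `e` is the identity, so enlarging `R` to all arcs changes nothing.
  refine h1.trans (congrArg₂ (fun a b => a ≫ N ≫ b) (P.ins_congr fun x => ?_)
    (Q.ins_congr fun x => ?_))
  · by_cases hx : P.label x = D.label p₀
    · exact .inr (iff_true_intro (hall (.inl x) hx))
    · exact .inl (he' _ hx)
  · by_cases hx : Q.label x = D.label p₀
    · exact .inr (iff_true_intro (hall (.inr x) hx))
    · exact .inl (he' _ hx)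

end Insert

/-! ### Change of the colour of a component -/

section Conj

variable {C : Type u} [Category.{v} C] [MonoidalCategory C] [RightRigidCategory C]
  {ι : Type} {c c' : ι → C}

/-- The change of colours of a row, along `p` on upward and along `q` on downward strands. -/
noncomputable def Ob.conj (p : ∀ i, c i ⟶ c' i) (q : ∀ i, c' i ⟶ c i) :
    (A : Ob ι) → (A.eval c ⟶ A.eval c')
  | .unit => 𝟙 _
  | .up i => p i
  | .down i => (q i)ᘁ
  | .tensor A B => A.conj p q ⊗ₘ B.conj p q

theorem Ob.conj_comp_conj (p : ∀ i, c i ⟶ c' i) (q : ∀ i, c' i ⟶ c i) (A : Ob ι) :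
    A.conj p q ≫ A.conj q p = A.ins c (fun i => p i ≫ q i) (fun _ => True) := by
  induction A with
  | unit => exact Category.id_comp _
  | up i => exact (pick_of trivial _).symm
  | down i =>
    exact (rightAdjointMate_comp_rightAdjointMate _ _).trans
      (congrArg rightAdjointMate (pick_of trivial _).symm)
  | tensor A B hA hB =>
    exact (tensorHom_comp_tensorHom _ _ _ _).trans (congrArg₂ (· ⊗ₘ ·) hA hB)

theorem Ob.conj_comp_conj_of_retract {p : ∀ i, c i ⟶ c' i} {q : ∀ i, c' i ⟶ c i}
    (h : ∀ i, p i ≫ q i = 𝟙 _) (A : Ob ι) : A.conj p q ≫ A.conj q p = 𝟙 _ := by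
  induction A with
  | unit => exact Category.id_comp _
  | up i => exact h i
  | down i =>
    exact (rightAdjointMate_comp_rightAdjointMate _ _).trans
      ((congrArg rightAdjointMate (h i)).trans rightAdjointMate_id)
  | tensor A B hA hB =>
    exact ((tensorHom_comp_tensorHom _ _ _ _).trans (congrArg₂ (· ⊗ₘ ·) hA hB)).trans
      (id_tensorHom_id _ _)

variable [BraidedCategory C] [RibbonCategory C]

/-- A tangle with the idempotents `p i ≫ q i` inserted at all arcs. -/
theorem Tangle.ins_true {p : ∀ i, c i ⟶ c' i} {q : ∀ i, c' i ⟶ c i} (h : ∀ i, q i ≫ p i = 𝟙 _)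
    {A B : Ob ι} (f : Tangle ι A B) :
    f.ins c (fun i => p i ≫ q i) (fun _ => True) = A.conj p q ≫ f.eval c' ≫ B.conj q p := by
  induction f with
  | id A => exact (A.conj_comp_conj p q).symm.trans (congrArg (_ ≫ ·) (Category.id_comp _).symm)
  | @comp A B D f g hf hg =>
    refine (congrArg₂ (· ≫ ·) hf hg).trans ?_
    -- On the middle row the two changes of colour meet in the order q ≫ p and cancel.
    have hB := B.conj_comp_conj_of_retract h
    simp only [Tangle.eval, Category.assoc, reassoc_of% hB]
  | tensor f g hf hg =>
    change (_ ⊗ₘ _) = (_ ⊗ₘ _) ≫ (_ ⊗ₘ _) ≫ (_ ⊗ₘ _)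
    rw [tensorHom_comp_tensorHom, tensorHom_comp_tensorHom]
    exact congrArg₂ (· ⊗ₘ ·) hf hg
  | assoc A B D =>
    exact (congrArg ((α_ _ _ _).hom ≫ ·) (Ob.conj_comp_conj p q (A.tensor (B.tensor D))).symm).trans
      (associator_naturality_assoc _ _ _ _).symm
  | assocInv A B D =>
    exact ((congrArg (· ≫ (α_ _ _ _).inv) (Ob.conj_comp_conj p q (A.tensor (B.tensor D))).symm).trans
      (Category.assoc _ _ _)).trans (congrArg (_ ≫ ·) (associator_inv_naturality _ _ _))
  | lunit A =>
    refine (congrArg (_ ≫ ·) (Ob.conj_comp_conj p q _).symm).trans ?_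
    exact (show (λ_ _).hom ≫ A.conj p q ≫ A.conj q p =
      (𝟙 (𝟙_ C) ⊗ₘ A.conj p q) ≫ (λ_ _).hom ≫ A.conj q p by simp)
  | lunitInv A =>
    refine (congrArg (· ≫ _) (Ob.conj_comp_conj p q _).symm).trans ?_
    exact (show (A.conj p q ≫ A.conj q p) ≫ (λ_ _).inv =
      A.conj p q ≫ (λ_ _).inv ≫ (𝟙 (𝟙_ C) ⊗ₘ A.conj q p) by simp)
  | runit A =>
    refine (congrArg (_ ≫ ·) (Ob.conj_comp_conj p q _).symm).trans ?_
    exact (show (ρ_ _).hom ≫ A.conj p q ≫ A.conj q p =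
      (A.conj p q ⊗ₘ 𝟙 (𝟙_ C)) ≫ (ρ_ _).hom ≫ A.conj q p by simp)
  | runitInv A =>
    refine (congrArg (· ≫ _) (Ob.conj_comp_conj p q _).symm).trans ?_
    exact (show (A.conj p q ≫ A.conj q p) ≫ (ρ_ _).inv =
      A.conj p q ≫ (ρ_ _).inv ≫ (A.conj q p ⊗ₘ 𝟙 (𝟙_ C)) by simp)
  | cross A B =>
    exact ((congrArg (· ≫ _) (Ob.conj_comp_conj p q (A.tensor B)).symm).trans
      (Category.assoc _ _ _)).trans (congrArg (_ ≫ ·) (BraidedCategory.braiding_naturality _ _))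
  | crossInv A B =>
    exact ((congrArg (· ≫ _) (Ob.conj_comp_conj p q (A.tensor B)).symm).trans
      (Category.assoc _ _ _)).trans
        (congrArg (_ ≫ ·) (BraidedCategory.braiding_inv_naturality _ _))
  | cupUD i =>
    refine (congrArg (fun g => _ ≫ g ▷ _) (pick_of trivial _)).trans ?_
    exact (show η_ (c i) (c i)ᘁ ≫ (p i ≫ q i) ▷ _ = 𝟙 _ ≫ η_ (c' i) (c' i)ᘁ ≫ (q i ⊗ₘ (p i)ᘁ) by
      rw [Category.id_comp, MonoidalCategory.tensorHom_def', ← Category.assoc (η_ _ _),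
        coevaluation_comp_rightAdjointMate]
      simp)
  | cupDU i =>
    refine (congrArg (fun g => _ ≫ _ ◁ g) (pick_of trivial _)).trans ?_
    exact (show coevL (c i) (c i)ᘁ ≫ _ ◁ (p i ≫ q i) =
        𝟙 _ ≫ coevL (c' i) (c' i)ᘁ ≫ ((p i)ᘁ ⊗ₘ q i) by
      rw [Category.id_comp, MonoidalCategory.tensorHom_def, ← Category.assoc (coevL _ _),
        coevL_comp_rightAdjointMate]
      simp)
  | capDU i =>
    refine (congrArg (fun g => _ ◁ g ≫ _) (pick_of trivial _)).trans ?_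
    exact (show _ ◁ (p i ≫ q i) ≫ ε_ (c i) (c i)ᘁ =
        ((q i)ᘁ ⊗ₘ p i) ≫ ε_ (c' i) (c' i)ᘁ ≫ 𝟙 _ by
      rw [Category.comp_id, MonoidalCategory.tensorHom_def', Category.assoc,
        rightAdjointMate_comp_evaluation]
      simp)
  | capUD i =>
    refine (congrArg (fun g => g ▷ _ ≫ _) (pick_of trivial _)).trans ?_
    exact (show (p i ≫ q i) ▷ _ ≫ evL (c i) (c i)ᘁ =
        (p i ⊗ₘ (q i)ᘁ) ≫ evL (c' i) (c' i)ᘁ ≫ 𝟙 _ by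
      rw [Category.comp_id, MonoidalCategory.tensorHom_def, Category.assoc,
        rightAdjointMate_comp_evL]
      simp)

end Conj

/-! ### A coupon at the spot, and retractions sliding around the first component -/

section Spot

section Category

variable {C : Type u} [Category.{v} C] {m : ℕ}

/-- The morphisms between colours which only change the colour of the first component. -/
def consHom {X Y : C} (f : X ⟶ Y) (r : Fin (m + 1) → C) : ∀ i : Fin (m + 2),
    (Fin.cons X r : Fin (m + 2) → C) i ⟶ (Fin.cons Y r : Fin (m + 2) → C) i :=
  Fin.cases f fun _ => 𝟙 _

theorem consHom_comp {X Y : C} {f : X ⟶ Y} {g : Y ⟶ X} (h : f ≫ g = 𝟙 X) (r : Fin (m + 1) → C)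
    (i : Fin (m + 2)) : consHom f r i ≫ consHom g r i = 𝟙 _ := by
  refine Fin.cases h (fun j => ?_) i
  exact Category.id_comp _

theorem comp_conj_comp {X Y U V : C} (a : X ⟶ U) (b : U ⟶ Y) {s : U ⟶ V} {N : V ⟶ V} {t : V ⟶ U}
    {K : U ⟶ U} (h : s ≫ N ≫ t = K) : (𝟙 X ≫ a ≫ s) ≫ N ≫ t ≫ b ≫ 𝟙 Y = a ≫ K ≫ b := by
  simp [← h]

variable [MonoidalCategory C]

theorem tensorHom_comp_whisker_comm {A B U V : C} (a : A ⟶ A) (b : B ⟶ B) (M : U ⊗ V ⟶ U ⊗ V) :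
    (a ⊗ₘ ((𝟙 U ⊗ₘ 𝟙 V) ⊗ₘ b)) ≫ A ◁ (M ▷ B) = A ◁ (M ▷ B) ≫ (a ⊗ₘ ((𝟙 U ⊗ₘ 𝟙 V) ⊗ₘ b)) := by
  rw [← id_tensorHom A, ← tensorHom_id M B, tensorHom_comp_tensorHom, tensorHom_comp_tensorHom,
    tensorHom_comp_tensorHom, tensorHom_comp_tensorHom]
  simp

theorem comp_whisker_comp_comp {A B U X Y : C} (a : X ⟶ A ⊗ U ⊗ B) (f M : U ⟶ U)
    (b : A ⊗ U ⊗ B ⟶ Y) :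
    a ≫ A ◁ ((f ≫ M) ▷ B) ≫ b = (a ≫ A ◁ (f ▷ B)) ≫ A ◁ (M ▷ B) ≫ b := by
  simp

theorem tensorHom_conj_whisker {A A' B B' U U' V : C} {a : A' ⟶ A} {a' : A ⟶ A'} {b : B' ⟶ B}
    {b' : B ⟶ B'} (ha : a ≫ a' = 𝟙 A') (hb : b ≫ b' = 𝟙 B') (q : U' ⟶ U) (p : U ⟶ U')
    (M : U ⊗ V ⟶ U ⊗ V) :
    (a ⊗ₘ ((q ⊗ₘ 𝟙 V) ⊗ₘ b)) ≫ A ◁ (M ▷ B) ≫ (a' ⊗ₘ ((p ⊗ₘ 𝟙 V) ⊗ₘ b')) =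
      A' ◁ ((q ▷ V ≫ M ≫ p ▷ V) ▷ B') := by
  rw [← id_tensorHom A, ← tensorHom_id M B, tensorHom_comp_tensorHom, tensorHom_comp_tensorHom,
    tensorHom_comp_tensorHom, tensorHom_comp_tensorHom, Category.id_comp, Category.id_comp, ha, hb]
  simp

end Category

variable {C : Type u} [Category.{v} C] [MonoidalCategory C] [BraidedCategory C]
  [RightRigidCategory C] [RibbonCategory C] {m : ℕ}

/-- The invariant of the closed diagram `P.comp Q` with a coupon `M` at the spot, where the first
component is coloured by `X` and the other ones by `r`. -/
def spotEval {A B : Ob (Fin (m + 2))} (P : Tangle (Fin (m + 2)) Ob.unit (spot A B))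
    (Q : Tangle (Fin (m + 2)) (spot A B) Ob.unit) (r : Fin (m + 1) → C) (X : C)
    (M : X ⊗ (r 0)ᘁ ⟶ X ⊗ (r 0)ᘁ) : 𝟙_ C ⟶ 𝟙_ C :=
  P.eval (Fin.cons X r : Fin (m + 2) → C) ≫
    (A.eval (Fin.cons X r : Fin (m + 2) → C) ◁ (M ▷ B.eval (Fin.cons X r : Fin (m + 2) → C))) ≫
      Q.eval (Fin.cons X r : Fin (m + 2) → C)

variable {A B : Ob (Fin (m + 2))} (P : Tangle (Fin (m + 2)) Ob.unit (spot A B))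
  (Q : Tangle (Fin (m + 2)) (spot A B) Ob.unit) (r : Fin (m + 1) → C)

/-- A retraction of the colour of the first component slides around this component. -/
theorem spotEval_of_retract (hL : (P.comp Q).IsLink) {X Y : C} (p : X ⟶ Y) (q : Y ⟶ X)
    (h : q ≫ p = 𝟙 Y) (M : X ⊗ (r 0)ᘁ ⟶ X ⊗ (r 0)ᘁ) :
    spotEval P Q r X ((p ≫ q) ▷ _ ≫ M) = spotEval P Q r Y (q ▷ _ ≫ M ≫ p ▷ _) := by
  let c : Fin (m + 2) → C := Fin.cons X r
  let e : ∀ i, c i ⟶ c i := fun i => consHom p r i ≫ consHom q r i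
  have he : ∀ i, e i ≫ e i = e i := fun i => by
    have := consHom_comp h r i
    simp only [e, Category.assoc, reassoc_of% this]
  have he' : ∀ i, i ≠ fst → e i = 𝟙 _ := fun i =>
    Fin.cases (fun h => (h rfl).elim) (fun j _ => Category.id_comp _) i
  let p₀ : (spot A B).Pt := .inr (.inl (.inl ()))
  let N : (spot A B).eval c ⟶ (spot A B).eval c := A.eval c ◁ (M ▷ B.eval c)
  -- Only the first component carries a nontrivial idempotent, so nothing happens on the downward
  -- strand of the spot. An insertion at a point other than p₀ is therefore trivial on both strands
  -- of the coupon and commutes with it.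
  have hd : ∀ s : Prop, (pick s (e snd))ᘁ = 𝟙 (c snd)ᘁ := fun s => by
    rw [he' snd (Fin.succ_ne_zero _), pick, ite_self, rightAdjointMate_id]
  have hN : ∀ x, x ≠ p₀ →
      (spot A B).ins c e (fun y => y = x) ≫ N = N ≫ (spot A B).ins c e (fun y => y = x) := by
    intro x hx
    have hx' : (spot A B).ins c e (fun y => y = x) =
        (A.ins c e fun y => .inl y = x) ⊗ₘ ((𝟙 X ⊗ₘ 𝟙 (r 0)ᘁ) ⊗ₘ
          (B.ins c e fun y => .inr (.inr y) = x)) :=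
      congrArg₂ (fun u d => (A.ins c e fun y => .inl y = x) ⊗ₘ ((u ⊗ₘ d) ⊗ₘ
          (B.ins c e fun y => .inr (.inr y) = x))) (pick_of_not (Ne.symm hx) (e fst)) (hd _)
    rw [hx']
    exact tensorHom_comp_whisker_comm _ _ M
  have hins : (spot A B).ins c e (fun y => y = p₀) =
      A.eval c ◁ (((p ≫ q) ▷ (r 0)ᘁ) ▷ B.eval c) := by
    have hA : (A.ins c e fun y => (.inl y : (spot A B).Pt) = p₀) = 𝟙 _ :=
      (A.ins_congr fun y => .inr (iff_false_intro Sum.inl_ne_inr)).trans A.ins_false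
    have hB : (B.ins c e fun y => (.inr (.inr y) : (spot A B).Pt) = p₀) = 𝟙 _ :=
      (B.ins_congr fun y => .inr (iff_false_intro fun h => Sum.inr_ne_inl (Sum.inr.inj h))).trans B.ins_false
    have hu : pick (p₀ = p₀) (e fst) = p ≫ q := pick_of rfl _
    have : (spot A B).ins c e (fun y => y = p₀) =
        𝟙 (A.eval c) ⊗ₘ (((p ≫ q) ⊗ₘ 𝟙 (r 0)ᘁ) ⊗ₘ 𝟙 (B.eval c)) :=
      congrArg₂ (fun (a : A.eval c ⟶ A.eval c) b => a ⊗ₘ b) hA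
        (congrArg₂ (fun u (b : B.eval c ⟶ B.eval c) => u ⊗ₘ b)
          (congrArg₂ (fun u d => u ⊗ₘ d) hu (hd _)) hB)
    rw [this, id_tensorHom, tensorHom_id, tensorHom_id]
  -- The idempotent below the coupon is absorbed by the arc of `P` which ends at p₀.
  have h₁ : spotEval P Q r X ((p ≫ q) ▷ _ ≫ M) =
      P.ins c e (fun x => False ∨ ∃ y, y = p₀ ∧ P.top y = x) ≫ N ≫
        Q.ins c e (fun _ => False) := by
    rw [← Tangle.ins_top he, Tangle.ins_false, Tangle.ins_false, hins]
    exact comp_whisker_comp_comp _ _ _ _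
  have h₂ := Tangle.ins_eq_ins_true he P Q p₀ (hL fst).2 he' N hN
    (fun x => False ∨ ∃ y, y = p₀ ∧ P.top y = x) (fun _ => False) (.inr ⟨_, rfl, rfl⟩)
  refine (h₁.trans h₂).trans ?_
  -- With the idempotent on all arcs both halves are evaluated in the colour Y. The changes of
  -- colour around the coupon turn M into q ▷ _ ≫ M ≫ p ▷ _ and cancel elsewhere.
  rw [Tangle.ins_true (consHom_comp h r), Tangle.ins_true (consHom_comp h r)]
  refine comp_conj_comp _ _ ((congrArg₂ (fun s t => s ≫ N ≫ t)
    (congrArg (fun d => (A.conj (consHom q r) (consHom p r) ⊗ₘ ((q ⊗ₘ d) ⊗ₘ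
      B.conj (consHom q r) (consHom p r)) :
        A.eval (Fin.cons Y r : Fin (m + 2) → C) ⊗ ((Y ⊗ (r 0)ᘁ) ⊗
          B.eval (Fin.cons Y r : Fin (m + 2) → C)) ⟶ A.eval c ⊗ ((X ⊗ (r 0)ᘁ) ⊗ B.eval c)))
      (rightAdjointMate_id (X := r 0)))
    (congrArg (fun d => (A.conj (consHom p r) (consHom q r) ⊗ₘ ((p ⊗ₘ d) ⊗ₘ
      B.conj (consHom p r) (consHom q r)) :
        A.eval c ⊗ ((X ⊗ (r 0)ᘁ) ⊗ B.eval c) ⟶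
          A.eval (Fin.cons Y r : Fin (m + 2) → C) ⊗ ((Y ⊗ (r 0)ᘁ) ⊗
            B.eval (Fin.cons Y r : Fin (m + 2) → C))))
      (rightAdjointMate_id (X := r 0)))).trans ?_)
  exact tensorHom_conj_whisker (A.conj_comp_conj_of_retract (consHom_comp h r))
    (B.conj_comp_conj_of_retract (consHom_comp h r)) q p M

end Spot

/-! ### Traces -/

section Trace

variable {C : Type u} [Category.{v} C] [MonoidalCategory C] [BraidedCategory C]
  [RightRigidCategory C] [RibbonCategory C]

/-- The trace of an endomorphism. -/
def tr {X : C} (f : X ⟶ X) : 𝟙_ C ⟶ 𝟙_ C := η_ X Xᘁ ≫ f ▷ Xᘁ ≫ evL X Xᘁ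

theorem tr_id (X : C) : tr (𝟙 X) = qdim X :=
  congrArg (_ ≫ ·) ((congrArg (· ≫ _) (id_whiskerRight _ _)).trans (Category.id_comp _))

/-- One factor passes over the maximum as its mate, down the dual strand, and back through the
minimum. -/
theorem tr_comp_comm {X Y : C} (f : X ⟶ Y) (g : Y ⟶ X) : tr (f ≫ g) = tr (g ≫ f) := by
  rw [tr, tr, comp_whiskerRight_assoc, ← rightAdjointMate_comp_evL g, ← whisker_exchange_assoc,
    ← Category.assoc, coevaluation_comp_rightAdjointMate]
  simp

/-- A maximum to the right of a strand. -/
def capRight (X V : C) : (X ⊗ V) ⊗ Vᘁ ⟶ X := (α_ _ _ _).hom ≫ X ◁ evL V Vᘁ ≫ (ρ_ X).hom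

/-- A minimum to the right of a strand. -/
def cupRight (X V : C) : X ⟶ (X ⊗ V) ⊗ Vᘁ := (ρ_ X).inv ≫ X ◁ η_ V Vᘁ ≫ (α_ _ _ _).inv

theorem bandHom_eq (X V : C) : bandHom X V = capRight X V ≫ cupRight X V := by
  simp [bandHom, capRight, cupRight]

/-- Computed with the dual Vᘁ ⊗ Xᘁ, the trace closes two nested strands; closing the inner one first
is the partial trace over V. -/
theorem tr_tensor {X V : C} (f : X ⊗ V ⟶ X ⊗ V) :
    tr f = tr (cupRight X V ≫ f ▷ Vᘁ ≫ capRight X V) := by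
  have h1 := coevaluation_comp_rightDualIso (Y₂ := (X ⊗ V)ᘁ)
    (ExactPairing.tensor (X₁ := X) (X₂ := V) (Y₁ := Xᘁ) (Y₂ := Vᘁ))
    (inferInstance : ExactPairing (X ⊗ V) (X ⊗ V)ᘁ)
  have h2 := rightDualIso_comp_evL (Y₂ := (X ⊗ V)ᘁ)
    (ExactPairing.tensor (X₁ := X) (X₂ := V) (Y₁ := Xᘁ) (Y₂ := Vᘁ))
    (inferInstance : ExactPairing (X ⊗ V) (X ⊗ V)ᘁ)
  calc tr f = η_ (X ⊗ V) (Vᘁ ⊗ Xᘁ) ≫ f ▷ _ ≫ evL (X ⊗ V) (Vᘁ ⊗ Xᘁ) := by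
        rw [tr, ← h2, ← whisker_exchange_assoc, ← h1, Category.assoc]
    _ = _ := by
        rw [evL_tensor, ExactPairing.tensor_coevaluation, tr, cupRight, capRight]
        monoidal

/-- By `ribbonPairing`, V is also a dual of Vᘁ, so the strand Vᘁ can be bent up to the right. -/
theorem exists_eq_whiskerRight_comp_capRight {T V W : C} (g : T ⊗ Vᘁ ⟶ W) :
    ∃ x : T ⟶ W ⊗ V, g = x ▷ Vᘁ ≫ capRight W V := by
  let := ribbonPairing V Vᘁ
  obtain ⟨x, rfl⟩ := (tensorRightHomEquiv T Vᘁ V W).symm.surjective g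
  exact ⟨x, rfl⟩

/-- The part of the closed diagram outside the coupon ρ is bent, by duality for S, into one morphism
κ that does not depend on ρ. -/
theorem exists_eq_tr_comp {S T Y : C} (a : 𝟙_ C ⟶ S ⊗ Y) (b : T ⊗ Y ⟶ 𝟙_ C) :
    ∃ κ : T ⟶ S, ∀ ρ : S ⟶ T, a ≫ ρ ▷ Y ≫ b = tr (ρ ≫ κ) := by
  obtain ⟨a', rfl⟩ := (tensorLeftHomEquiv (𝟙_ C) S Sᘁ Y).surjective a
  let := ribbonPairing S Sᘁ
  obtain ⟨κ, hκ⟩ := (tensorRightHomEquiv T Sᘁ S (𝟙_ C)).symm.surjective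
    (T ◁ ((ρ_ _).inv ≫ a') ≫ b)
  refine ⟨κ ≫ (λ_ _).hom, fun ρ => ?_⟩
  have h1 : tensorLeftHomEquiv (𝟙_ C) S Sᘁ Y a' = η_ S Sᘁ ≫ S ◁ ((ρ_ _).inv ≫ a') := by
    simp [tensorLeftHomEquiv, unitors_inv_equal]
  have h2 : (tensorRightHomEquiv T Sᘁ S (𝟙_ C)).symm κ = (κ ≫ (λ_ _).hom) ▷ _ ≫ evL S Sᘁ := by
    change κ ▷ _ ≫ (α_ _ _ _).hom ≫ _ ◁ evL S Sᘁ ≫ (ρ_ _).hom = _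
    rw [← unitors_equal]
    simp
  rw [h1, Category.assoc, whisker_exchange_assoc, ← hκ, h2, tr]
  simp

/-- The braiding carries the strands `A` to the other side of the coupon; it cancels with its
inverse by naturality. -/
theorem exists_whisker_eq_tr_comp {A B S T : C} (a : 𝟙_ C ⟶ A ⊗ (S ⊗ B))
    (b : A ⊗ (T ⊗ B) ⟶ 𝟙_ C) :
    ∃ κ : T ⟶ S, ∀ ρ : S ⟶ T, a ≫ A ◁ (ρ ▷ B) ≫ b = tr (ρ ≫ κ) := by
  obtain ⟨κ, hκ⟩ := exists_eq_tr_comp (a ≫ (β_ A (S ⊗ B)).hom ≫ (α_ _ _ _).hom)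
    ((α_ _ _ _).inv ≫ (β_ A (T ⊗ B)).inv ≫ b)
  refine ⟨κ, fun ρ => ?_⟩
  rw [← hκ, MonoidalCategory.whiskerRight_tensor]
  simp only [Category.assoc, Iso.hom_inv_id_assoc]
  rw [← BraidedCategory.braiding_naturality_right_assoc, Iso.hom_inv_id_assoc]

/-- The invariant of a tangle without ends, as an endomorphism of the unit object. -/
def Tangle.scalar {ι : Type} (f : Tangle ι Ob.unit Ob.unit) (X : ι → C) : 𝟙_ C ⟶ 𝟙_ C := f.eval X

variable {m : ℕ} {A B : Ob (Fin (m + 2))} (P : Tangle (Fin (m + 2)) Ob.unit (spot A B))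
  (Q : Tangle (Fin (m + 2)) (spot A B) Ob.unit) (r : Fin (m + 1) → C)

theorem spotEval_id (X : C) : spotEval P Q r X (𝟙 _) = (P.comp Q).scalar (Fin.cons X r) := by
  have h {A U B : C} (a : 𝟙_ C ⟶ A ⊗ (U ⊗ B)) (b : A ⊗ (U ⊗ B) ⟶ 𝟙_ C) :
      a ≫ A ◁ (𝟙 U ▷ B) ≫ b = a ≫ b := by simp
  exact h _ _

end Trace

/-! ### Negligible morphisms, and cyclicity around the first component -/

section Negligible

variable {C : Type u} [Category.{v} C] [MonoidalCategory C] [BraidedCategory C]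
  [RightRigidCategory C] [RibbonCategory C] [Preadditive C] [MonoidalPreadditive C] {m : ℕ}

theorem tr_zero (X : C) : tr (0 : X ⟶ X) = 0 := by simp [tr]

/-- The closed diagram is the trace of ρ ≫ κ for a suitable κ, and hρ kills this composite. -/
theorem comp_whisker_eq_zero {A B U S T : C} (a : 𝟙_ C ⟶ A ⊗ (U ⊗ B)) (b : A ⊗ (U ⊗ B) ⟶ 𝟙_ C)
    {ρ : S ⟶ T} (hρ : ∀ κ : T ⟶ S, ρ ≫ κ = 0) (φ : U ⟶ S) (ψ : T ⟶ U) :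
    a ≫ A ◁ ((φ ≫ ρ ≫ ψ) ▷ B) ≫ b = 0 := by
  obtain ⟨κ, hκ⟩ := exists_whisker_eq_tr_comp (a ≫ A ◁ (φ ▷ B)) (A ◁ (ψ ▷ B) ≫ b)
  refine Eq.trans ?_ ((hκ ρ).trans (by rw [hρ, tr_zero]))
  simp

theorem comp_whisker_whiskerRight_eq_zero {A B U S T V : C} (a : 𝟙_ C ⟶ A ⊗ (U ⊗ B))
    (b : A ⊗ (U ⊗ B) ⟶ 𝟙_ C) {ρ : S ⟶ T} (hρ : ∀ κ : T ⟶ S, ρ ≫ κ = 0) (φ : U ⟶ S ⊗ V)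
    (ψ : T ⊗ V ⟶ U) : a ≫ A ◁ ((φ ≫ ρ ▷ V ≫ ψ) ▷ B) ≫ b = 0 := by
  obtain ⟨κ, hκ⟩ := exists_whisker_eq_tr_comp (a ≫ A ◁ (φ ▷ B ≫ (α_ S V B).hom))
    (A ◁ ((α_ T V B).inv ≫ ψ ▷ B) ≫ b)
  refine Eq.trans ?_ ((hκ ρ).trans (by rw [hρ, tr_zero]))
  simp

variable {A B : Ob (Fin (m + 2))} (P : Tangle (Fin (m + 2)) Ob.unit (spot A B))
  (Q : Tangle (Fin (m + 2)) (spot A B) Ob.unit) (r : Fin (m + 1) → C) {X : C}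

theorem spotEval_comp_eq_zero {S T : C} {ρ : S ⟶ T} (hρ : ∀ κ : T ⟶ S, ρ ≫ κ = 0)
    (φ : X ⊗ (r 0)ᘁ ⟶ S) (ψ : T ⟶ X ⊗ (r 0)ᘁ) : spotEval P Q r X (φ ≫ ρ ≫ ψ) = 0 :=
  comp_whisker_eq_zero _ _ hρ φ ψ

theorem spotEval_comp_whiskerRight_comp_eq_zero {S T : C} {ρ : S ⟶ T}
    (hρ : ∀ κ : T ⟶ S, ρ ≫ κ = 0)
    (φ : X ⊗ (r 0)ᘁ ⟶ S ⊗ (r 0)ᘁ) (ψ : T ⊗ (r 0)ᘁ ⟶ X ⊗ (r 0)ᘁ) :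
    spotEval P Q r X (φ ≫ ρ ▷ _ ≫ ψ) = 0 :=
  comp_whisker_whiskerRight_eq_zero _ _ hρ φ ψ

theorem spotEval_add (M N : X ⊗ (r 0)ᘁ ⟶ X ⊗ (r 0)ᘁ) :
    spotEval P Q r X (M + N) = spotEval P Q r X M + spotEval P Q r X N := by
  have h {A U B : C} (a : 𝟙_ C ⟶ A ⊗ (U ⊗ B)) (b : A ⊗ (U ⊗ B) ⟶ 𝟙_ C) (M N : U ⟶ U) :
      a ≫ A ◁ ((M + N) ▷ B) ≫ b = a ≫ A ◁ (M ▷ B) ≫ b + a ≫ A ◁ (N ▷ B) ≫ b := by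
    simp [MonoidalPreadditive.add_whiskerRight, MonoidalPreadditive.whiskerLeft_add]
  exact h _ _ _ _

theorem spotEval_sum {J : Type*} (s : Finset J) (M : J → (X ⊗ (r 0)ᘁ ⟶ X ⊗ (r 0)ᘁ)) :
    spotEval P Q r X (∑ j ∈ s, M j) = ∑ j ∈ s, spotEval P Q r X (M j) :=
  map_sum (AddMonoidHom.mk' (spotEval P Q r X) (spotEval_add P Q r)) M s

variable {K : Type w} [Field K] [Linear K C] [MonoidalLinear K C]

theorem tr_smul {X : C} (k : K) (f : X ⟶ X) : tr (k • f) = k • tr f := by simp [tr]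

theorem spotEval_smul (k : K) (M : X ⊗ (r 0)ᘁ ⟶ X ⊗ (r 0)ᘁ) :
    spotEval P Q r X (k • M) = k • spotEval P Q r X M := by
  have h {A U B : C} (a : 𝟙_ C ⟶ A ⊗ (U ⊗ B)) (b : A ⊗ (U ⊗ B) ⟶ 𝟙_ C) (M : U ⟶ U) :
      a ≫ A ◁ ((k • M) ▷ B) ≫ b = k • (a ≫ A ◁ (M ▷ B) ≫ b) := by
    simp
  exact h _ _ _

/-- The colour of the first component is changed by sliding a morphism around this component. -/
theorem spotEval_cyclic (hL : (P.comp Q).IsLink) {Z S : C} (hS : IsSimpleObj K S) (p : Z ⟶ S)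
    (q : S ⟶ Z) (M : Z ⊗ (r 0)ᘁ ⟶ Z ⊗ (r 0)ᘁ) :
    spotEval P Q r Z ((p ≫ q) ▷ _ ≫ M) = spotEval P Q r S (q ▷ _ ≫ M ≫ p ▷ _) := by
  -- If q ≫ p is a nonzero scalar k, then p and k⁻¹ • q form a retraction onto S, and
  -- `spotEval_of_retract` applies.
  have key : ∀ p : Z ⟶ S, q ≫ p ≠ 0 →
      spotEval P Q r Z ((p ≫ q) ▷ _ ≫ M) = spotEval P Q r S (q ▷ _ ≫ M ≫ p ▷ _) := by
    intro p hp
    obtain ⟨k, hk : k • 𝟙 S = q ≫ p⟩ := hS.2 (q ≫ p)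
    have hk0 : k ≠ 0 := by
      rintro rfl
      exact hp (by rw [← hk, zero_smul])
    have h := spotEval_of_retract P Q r hL p (k⁻¹ • q)
      (by rw [Linear.smul_comp, ← hk, smul_smul, inv_mul_cancel₀ hk0, one_smul]) M
    simp only [Linear.comp_smul, MonoidalLinear.smul_whiskerRight, Linear.smul_comp,
      spotEval_smul] at h
    exact smul_right_injective _ (inv_ne_zero hk0) h
  by_cases h : ∃ p' : Z ⟶ S, q ≫ p' ≠ 0
  · obtain ⟨p', hp'⟩ := h
    by_cases hp : q ≫ p = 0
    -- Both sides are additive in `p`, and the statement holds for p' and for p' + p.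
    · have h₁ := key p' hp'
      have h₂ := key (p' + p) (by rwa [Preadditive.comp_add, hp, add_zero])
      simp only [Preadditive.add_comp, MonoidalPreadditive.add_whiskerRight, Preadditive.comp_add,
        spotEval_add] at h₂
      rw [h₁] at h₂
      exact add_left_cancel h₂
    · exact key p hp
  -- Here q is negligible, and both sides vanish.
  · have h0 : ∀ p' : Z ⟶ S, q ≫ p' = 0 := by simpa using h
    have e₁ := spotEval_comp_whiskerRight_comp_eq_zero P Q r h0 (p ▷ _) M
    have e₂ := spotEval_comp_whiskerRight_comp_eq_zero P Q r h0 (𝟙 _) (M ≫ p ▷ _)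
    rw [Category.id_comp] at e₂
    rw [comp_whiskerRight_assoc, e₁, e₂]

end Negligible

section Sliding

/-! ### Sliding in a premodular category -/

section Simple

variable {K : Type w} [Field K] {C : Type u} [Category.{v} C] [Preadditive C] [Linear K C]

/-- A weak form of Schur's lemma: by associativity the scalars ρ ≫ κ and κ ≫ ρ agree if the first is
nonzero, and then ρ is invertible. The vanishing of ρ itself is not claimed. -/
theorem IsSimpleObj.comp_eq_zero {S T : C} (hS : IsSimpleObj K S) (hT : IsSimpleObj K T)
    (h : ¬ Nonempty (S ≅ T)) (ρ : S ⟶ T) (κ : T ⟶ S) : ρ ≫ κ = 0 := by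
  obtain ⟨k, hk : k • 𝟙 S = ρ ≫ κ⟩ := hS.2 (ρ ≫ κ)
  obtain ⟨l, hl : l • 𝟙 T = κ ≫ ρ⟩ := hT.2 (κ ≫ ρ)
  by_contra h0
  have hk0 : k ≠ 0 := by
    rintro rfl
    exact h0 (by rw [← hk, zero_smul])
  have hρ : ρ ≠ 0 := by
    rintro rfl
    exact h0 Limits.zero_comp
  have hkl : k • ρ = l • ρ := by
    have := Category.assoc ρ κ ρ
    rwa [← hk, ← hl, Linear.smul_comp, Linear.comp_smul, Category.id_comp,
      Category.comp_id] at this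
  obtain rfl : k = l := smul_left_injective K hρ hkl
  exact h ⟨⟨ρ, k⁻¹ • κ,
    by rw [Linear.comp_smul, ← hk, smul_smul, inv_mul_cancel₀ hk0, one_smul],
    by rw [Linear.smul_comp, ← hl, smul_smul, inv_mul_cancel₀ hk0, one_smul]⟩⟩

end Simple

variable {K : Type w} [Field K] {G : Type*} [AddCommGroup G]
  {C : Type u} [Category.{v} C] [MonoidalCategory C] [Preadditive C] [Linear K C]
  [RightRigidCategory C] [GGrading G C]

theorem Representatives.comp_eq_zero (R : Representatives K G C) {α : G}
    {i j : SimpleClass K G C α} (h : i ≠ j) (ρ : (R.obj α i).1 ⟶ (R.obj α j).1)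
    (κ : (R.obj α j).1 ⟶ (R.obj α i).1) : ρ ≫ κ = 0 :=
  (R.obj α i).2.1.comp_eq_zero (R.obj α j).2.1
    (fun e => h (by rw [← R.mk_obj α i, ← R.mk_obj α j]; exact Quotient.sound e)) ρ κ

variable [Premodular K G C]

theorem Representatives.exists_decomposition (R : Representatives K G C) {α : G}
    [Fintype (SimpleClass K G C α)] (X : C) (hX : GGrading.deg X = α) :
    ∃ (n : ℕ) (p : ∀ i, Fin n → (X ⟶ (R.obj α i).1)) (q : ∀ i, Fin n → ((R.obj α i).1 ⟶ X)),
      𝟙 X = ∑ i, ∑ a, p i a ≫ q i a := by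
  classical
  subst hX
  obtain ⟨n, S, f, g, h⟩ := Premodular.dominated (K := K) (G := G) X
  let c (a : Fin n) : SimpleClass K G C (GGrading.deg X) := Quotient.mk _ (S a)
  have he (a : Fin n) : Nonempty ((S a).1 ≅ (R.obj _ (c a)).1) :=
    Quotient.exact (R.mk_obj _ (c a)).symm
  let e (a : Fin n) := (he a).some
  -- All classes share the index set of the given decomposition; a summand is transported to the
  -- representative of its own class and is zero at the others.
  refine ⟨n, fun i a => if h : c a = i then g a ≫ (e a).hom ≫ eqToHom (by rw [h]) else 0,
    fun i a => if h : c a = i then eqToHom (by rw [h]) ≫ (e a).inv ≫ f a else 0, ?_⟩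
  rw [h, Finset.sum_comm]
  refine Finset.sum_congr rfl fun a _ => ?_
  rw [Finset.sum_eq_single (c a)]
  · simp
  · intro i _ hi
    simp [hi.symm]
  · simp

variable [BraidedCategory C] [RibbonCategory C]

variable (K G) in
theorem dimScalar_smul (X : C) : dimScalar K G X • 𝟙 (𝟙_ C) = qdim X :=
  (Equiv.ofBijective _ (Premodular.unit_simple (K := K) (G := G) (C := C))).apply_symm_apply _

variable [MonoidalPreadditive C] [MonoidalLinear K C]

variable (G) in
-- Both sides are the trace of x ≫ p: it equals `b` times the dimension of T, and after cyclic
-- exchange and a partial trace over V it equals `a` times the dimension of W.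
theorem dimScalar_mul_eq {T V W : C} (x : T ⟶ W ⊗ V) (p : W ⊗ V ⟶ T) {a b : K}
    (ha : cupRight W V ≫ p ▷ Vᘁ ≫ x ▷ Vᘁ ≫ capRight W V = a • 𝟙 W) (hb : x ≫ p = b • 𝟙 T) :
    dimScalar K G T * b = dimScalar K G W * a := by
  refine (Premodular.unit_simple (K := K) (G := G) (C := C)).1 ?_
  change (_ * _) • 𝟙 (𝟙_ C) = (_ * _) • 𝟙 (𝟙_ C)
  rw [mul_comm, mul_smul, mul_comm, mul_smul, dimScalar_smul, dimScalar_smul, ← tr_id, ← tr_id,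
    ← tr_smul, ← tr_smul, ← ha, ← hb, tr_comp_comm, tr_tensor, comp_whiskerRight_assoc]

variable {m : ℕ} {A B : Ob (Fin (m + 2))} (P : Tangle (Fin (m + 2)) Ob.unit (spot A B))
  (Q : Tangle (Fin (m + 2)) (spot A B) Ob.unit) (r : Fin (m + 1) → C)

variable (K G) in
-- Bend g b to x b : T ⟶ W ⊗ r 0. Both sides then expand into the same values, those of q a ▷ _ ≫
-- capRight ≫ f b. The coefficients come from x b ≫ p a on T on the left and from its partial-trace
-- counterpart on W on the right, and `dimScalar_mul_eq` matches them. The hypotheses hgf and hpq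
-- express that, inside the evaluation, a decomposition of the identity may be restricted to its
-- summands through W alone or T alone.
theorem dimScalar_smul_sum_spotEval {T W : C} (hT : IsSimpleObj K T) (hW : IsSimpleObj K W)
    {I J : Type*} [Fintype I] [Fintype J] (p : I → (W ⊗ r 0 ⟶ T)) (q : I → (T ⟶ W ⊗ r 0))
    (g : J → (T ⊗ (r 0)ᘁ ⟶ W)) (f : J → (W ⟶ T ⊗ (r 0)ᘁ))
    (hgf : ∀ (φ : _ ⟶ W) ψ, spotEval P Q r T (φ ≫ ψ) = ∑ b, spotEval P Q r T (φ ≫ (ψ ≫ g b) ≫ f b))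
    (hpq : ∀ (x : T ⟶ W ⊗ r 0) ψ, spotEval P Q r T (x ▷ (r 0)ᘁ ≫ ψ) =
      ∑ a, spotEval P Q r T ((x ≫ p a) ▷ (r 0)ᘁ ≫ q a ▷ (r 0)ᘁ ≫ ψ)) :
    dimScalar K G T • ∑ b, spotEval P Q r T (g b ≫ f b) =
      dimScalar K G W • ∑ a, spotEval P Q r T
        (q a ▷ (r 0)ᘁ ≫ capRight W (r 0) ≫ cupRight W (r 0) ≫ p a ▷ (r 0)ᘁ) := by
  choose x hx using fun b => exists_eq_whiskerRight_comp_capRight (g b)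
  choose u hu using fun a b =>
    hW.2 (cupRight W (r 0) ≫ p a ▷ (r 0)ᘁ ≫ x b ▷ (r 0)ᘁ ≫ capRight W (r 0))
  choose w hw using fun a b => hT.2 (x b ≫ p a)
  have e₁ (b) : spotEval P Q r T (g b ≫ f b) =
      ∑ a, w a b • spotEval P Q r T (q a ▷ (r 0)ᘁ ≫ capRight W (r 0) ≫ f b) := by
    rw [hx b, Category.assoc, hpq]
    refine Finset.sum_congr rfl fun a _ => ?_
    rw [← hw a b, MonoidalLinear.smul_whiskerRight, Linear.smul_comp, id_whiskerRight,
      Category.id_comp, spotEval_smul]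
  have e₂ (a) : spotEval P Q r T
        (q a ▷ (r 0)ᘁ ≫ capRight W (r 0) ≫ cupRight W (r 0) ≫ p a ▷ (r 0)ᘁ) =
      ∑ b, u a b • spotEval P Q r T (q a ▷ (r 0)ᘁ ≫ capRight W (r 0) ≫ f b) := by
    have := hgf (q a ▷ (r 0)ᘁ ≫ capRight W (r 0)) (cupRight W (r 0) ≫ p a ▷ (r 0)ᘁ)
    rw [Category.assoc] at this
    rw [this]
    refine Finset.sum_congr rfl fun b _ => ?_
    rw [hx b, Category.assoc (cupRight _ _), ← hu a b, Linear.smul_comp, Linear.comp_smul,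
      Category.id_comp, spotEval_smul, Category.assoc]
  simp only [e₁, e₂, Finset.smul_sum, smul_smul]
  rw [Finset.sum_comm]
  refine Finset.sum_congr rfl fun a _ => Finset.sum_congr rfl fun b _ => ?_
  rw [dimScalar_mul_eq G (x b) (p a) (hu a b).symm (hw a b).symm]

/-- This is the sliding property when all components other than the first have fixed objects as
colours. -/
theorem sum_scalar_comp_eq_sum_scalar_slide (R : Representatives K G C) (hL : (P.comp Q).IsLink)
    {α γ : G} [Fintype (SimpleClass K G C α)] [Fintype (SimpleClass K G C γ)]
    (h : γ + GGrading.deg (r 0) = α) :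
    ∑ i, dimScalar K G (R.obj α i).1 • (P.comp Q).scalar (Fin.cons (R.obj α i).1 r) =
      ∑ j, dimScalar K G (R.obj γ j).1 • (slide P Q).scalar (Fin.cons (R.obj γ j).1 r) := by
  -- The grading ensures that decomposing these two kinds of objects involves only the simple
  -- objects of degree α, respectively γ.
  have hα (j) : GGrading.deg ((R.obj γ j).1 ⊗ r 0) = α := by
    rw [GGrading.deg_tensor, (R.obj γ j).2.2, h]
  have hγ (i) : GGrading.deg ((R.obj α i).1 ⊗ (r 0)ᘁ) = γ := by
    rw [GGrading.deg_tensor, GGrading.deg_dual, (R.obj α i).2.2, ← h, add_neg_cancel_right]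
  choose n p q hpq using fun j => R.exists_decomposition _ (hα j)
  choose l g f hgf using fun i => R.exists_decomposition _ (hγ i)
  have e₁ (i) : (P.comp Q).scalar (Fin.cons (R.obj α i).1 r) =
      ∑ j, ∑ b, spotEval P Q r (R.obj α i).1 (g i j b ≫ f i j b) := by
    rw [← spotEval_id, hgf i]
    simp only [spotEval_sum]
  have e₂ (j) : (slide P Q).scalar (Fin.cons (R.obj γ j).1 r) =
      ∑ i, ∑ a, spotEval P Q r (R.obj α i).1 (q j i a ▷ (r 0)ᘁ ≫
        capRight (R.obj γ j).1 (r 0) ≫ cupRight (R.obj γ j).1 (r 0) ≫ p j i a ▷ (r 0)ᘁ) := by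
    have e₃ : bandHom (R.obj γ j).1 (r 0) =
        ∑ i, ∑ a, (p j i a ≫ q j i a) ▷ (r 0)ᘁ ≫ bandHom (R.obj γ j).1 (r 0) := by
      simp only [← Preadditive.sum_comp, ← sum_whiskerRight, ← hpq j, id_whiskerRight,
        Category.id_comp]
    refine (eval_slide P Q (R.obj γ j).1 r).trans ?_
    change spotEval P Q r _ _ = _
    rw [e₃]
    -- Each p j i a travels once around the first component, whose colour becomes the simple object
    -- of degree α.
    simp only [spotEval_sum, spotEval_cyclic P Q r hL (R.obj α _).2.1, bandHom_eq, Category.assoc]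
  simp only [e₁, e₂, Finset.smul_sum (s := (Finset.univ : Finset (SimpleClass K G C _)))]
  rw [Finset.sum_comm]
  refine Finset.sum_congr rfl fun j _ => Finset.sum_congr rfl fun i _ => ?_
  refine dimScalar_smul_sum_spotEval K G P Q r (R.obj α i).2.1 (R.obj γ j).2.1 _ _ _ _ ?_ ?_
  · intro φ ψ
    have e : φ ≫ ψ = ∑ j', ∑ b, φ ≫ (ψ ≫ g i j' b) ≫ f i j' b := by
      simp only [Category.assoc, ← Preadditive.comp_sum, ← hgf i, Category.comp_id]
    rw [e]
    simp only [spotEval_sum]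
    -- The morphism ψ ≫ g i j' b goes between non-isomorphic simple objects when j' ≠ j, so it is
    -- negligible.
    refine Finset.sum_eq_single j (fun j' _ hj => Finset.sum_eq_zero fun b _ => ?_) (by simp)
    exact spotEval_comp_eq_zero P Q r (R.comp_eq_zero hj.symm _) _ _
  · intro x ψ
    have e : x ▷ (r 0)ᘁ ≫ ψ =
        ∑ i', ∑ a, (x ≫ p j i' a) ▷ (r 0)ᘁ ≫ q j i' a ▷ (r 0)ᘁ ≫ ψ := by
      simp only [← comp_whiskerRight_assoc, Category.assoc, ← Preadditive.sum_comp,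
        ← sum_whiskerRight, ← Preadditive.comp_sum, ← hpq j, Category.comp_id]
    rw [e]
    simp only [spotEval_sum]
    -- Likewise x ≫ p j i' a is negligible for i' ≠ i.
    refine Finset.sum_eq_single i (fun i' _ hi => Finset.sum_eq_zero fun a _ => ?_) (by simp)
    have := spotEval_comp_whiskerRight_comp_eq_zero P Q r
      (R.comp_eq_zero hi.symm (x ≫ p j i' a)) (𝟙 _) (q j i' a ▷ (r 0)ᘁ ≫ ψ)
    rwa [Category.id_comp] at this

end Sliding

section Bracket

/-! ### Expansion of the invariant in the colour of the first component -/

section Colours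

variable {K : Type w} [Field K] {C M : Type*} [AddCommGroup M] [Module K M]

/-- The multilinear extension of a function of `n` colours. -/
def multilinearSum {n : ℕ} (f : (Fin n → C) → M) (X : Fin n → (C →₀ K)) : M :=
  ∑ c ∈ Fintype.piFinset fun i => (X i).support, (∏ i, X i (c i)) • f c

theorem multilinearSum_cons {n : ℕ} (f : (Fin (n + 1) → C) → M) (x : C →₀ K)
    (X : Fin n → (C →₀ K)) : multilinearSum f (Fin.cons x X) =
      Finsupp.linearCombination K (fun c => multilinearSum (fun d => f (Fin.cons c d)) X) x := by
  simp only [Finsupp.linearCombination_apply, Finsupp.sum, multilinearSum, Finset.smul_sum]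
  rw [← Finset.sum_product']
  refine Finset.sum_nbij' (fun c => (c 0, Fin.tail c)) (fun p => Fin.cons p.1 p.2) ?_ ?_ ?_ ?_ ?_
  · intro c hc
    rw [Fintype.mem_piFinset] at hc
    exact Finset.mem_product.2 ⟨hc 0, Fintype.mem_piFinset.2 fun i => hc i.succ⟩
  · rintro ⟨c, d⟩ h
    rw [Finset.mem_product, Fintype.mem_piFinset] at h
    exact Fintype.mem_piFinset.2 (Fin.cases h.1 h.2)
  · intro c _
    exact Fin.cons_self_tail c
  · intro _ _
    rfl
  · intro c _
    simp only [Fin.prod_univ_succ, Fin.cons_zero, Fin.cons_succ, Fin.cons_self_tail, mul_smul]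
    rfl

end Colours

variable {K : Type w} [Field K] {G : Type*} [AddCommGroup G]
  {C : Type u} [Category.{v} C] [MonoidalCategory C] [Preadditive C] [Linear K C]
  [RightRigidCategory C] [GGrading G C] [BraidedCategory C] [RibbonCategory C]

theorem FramedLink.bracket_eq {n : ℕ} (L : FramedLink n) (X : Fin n → (C →₀ K)) :
    L.bracket X = multilinearSum L.diagram.scalar X := rfl

variable [Premodular K G C]

theorem linearCombination_omega (R : Representatives K G C) (α : G)
    [Fintype (SimpleClass K G C α)] {M : Type*} [AddCommGroup M] [Module K M] (f : C → M) :
    Finsupp.linearCombination K f (omega R α) =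
      ∑ i, dimScalar K G (R.obj α i).1 • f (R.obj α i).1 := by
  rw [omega, map_sum]
  simp only [Finsupp.linearCombination_single]
  convert rfl

/-- Only the first two colours are expanded. The remaining ones stay in an outer multilinear sum, so
that two brackets can be compared for each fixed choice of objects. -/
theorem bracket_omega_single (R : Representatives K G C) (α : G)
    [Fintype (SimpleClass K G C α)] {m : ℕ} (L : FramedLink (m + 2)) (V : C)
    (X : Fin m → (C →₀ K)) :
    L.bracket (Fin.cons (omega R α) (Fin.cons (Finsupp.single V 1) X)) =
      multilinearSum (fun c => ∑ i, dimScalar K G (R.obj α i).1 •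
        L.diagram.scalar (Fin.cons (R.obj α i).1 (Fin.cons V c))) X := by
  rw [L.bracket_eq, multilinearSum_cons, linearCombination_omega]
  simp only [multilinearSum_cons, Finsupp.linearCombination_single, one_smul]
  simp only [multilinearSum, Finset.smul_sum]
  rw [Finset.sum_comm]
  simp only [smul_comm (dimScalar K G _)]

end Bracket

end GradedSliding

theorem mainTheorem10 {K : Type*} [Field K] [CharZero K] {G : Type*} [AddCommGroup G]
    {C : Type*} [Category* C] [MonoidalCategory C] [Preadditive C] [Linear K C]
    [MonoidalPreadditive C] [MonoidalLinear K C] [RightRigidCategory C] [BraidedCategory C]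
    [RibbonCategory C] [GGrading G C] [Premodular K G C] (R : Representatives K G C)
    {m : ℕ} (L L' : FramedLink (m + 2)) (hL : L.IsSlide L') (α β : G)
    (V : C) (hV : GGrading.deg V = β) (X : Fin m → (C →₀ K)) :
    L.bracket (Fin.cons (omega R α) (Fin.cons (Finsupp.single V 1) X)) =
      L'.bracket (Fin.cons (omega R (α - β)) (Fin.cons (Finsupp.single V 1) X)) := by
  have hfin (γ : G) : Finite (SimpleClass K G C γ) := Premodular.finite_simple γ
  let (γ : G) : Fintype (SimpleClass K G C γ) := Fintype.ofFinite _
  obtain ⟨A, B, P, Q, hPQ, h, h'⟩ := hL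
  have e (c : Fin (m + 2) → C) : L.diagram.scalar c = (P.comp Q).scalar c := h.eval_eq c
  have e' (c : Fin (m + 2) → C) : L'.diagram.scalar c = (slide P Q).scalar c := h'.eval_eq c
  rw [bracket_omega_single, bracket_omega_single]
  -- It suffices to compare the inner sums for fixed objects `c`; the degrees fit because (α - β) +
  -- β = α.
  congr 1
  funext c
  simp only [e, e']
  exact sum_scalar_comp_eq_sum_scalar_slide P Q (Fin.cons V c) R hPQ
    (by rw [Fin.cons_zero, hV, sub_add_cancel])
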